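/- Let $D\subset\mathbb C^n$ be a $\mathbb C$-convex domain, i.e. a nonempty connected open set whose nonempty intersections with complex lines are all connected and simply connected, and suppose that $D$ contains no complex line. Let $c_D$ be the Carathéodory distance of $D$, that is, $c_D(z,w)=\sup_f p(f(z),f(w))$, the supremum being over all holomorphic functions $f$ from $D$ to the unit disc $\mathbb D\subset\mathbb C$, where $p(\lambda,\mu)=\tanh^{-1}\left|\frac{\lambda-\mu}{1-\overline{\mu}\lambda}\right|$ is the Poincaré distance on $\mathbb D$. Then: (1) $D$ is biholomorphic to a bounded domain in $\mathbb C^n$; (2) $D$ is $c$-finitely compact: for each $a\in D$ and $r>0$ the ball $\{z\in D: c_D(a,z)<r\}$ is relatively compact in $D$; (3) $D$ is $c$-complete: $c_D(z,w)>0$ for all $z\neq w$ in $D$, and each $c_D$-Cauchy sequence in $D$ converges, in the usual topology, to a point of $D$; (4) $D$ is hyperconvex: there is a continuous plurisubharmonic function $u:D\to(-\infty,0)$ such that $\{z\in D:u(z)<-t\}$ is relatively compact in $D$ for each $t>0$; (5) $D$ is taut: each sequence of holomorphic maps $\mathbb D\to D$ has a subsequence that either converges locally uniformly on $\mathbb D$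 to a holomorphic map $\mathbb D\to D$, or diverges compactly (for all compact $K\subset\mathbb D$ and $L\subset D$, all but finitely many maps $\varphi$ of the subsequence satisfy $\varphi(K)\cap L=\varnothing$). -/

import Mathlib

open Set Filter Topology Metric
open scoped ENNReal

noncomputable section

/-- The space `ℂⁿ`. -/
abbrev CSpace (n : ℕ) : Type := EuclideanSpace ℂ (Fin n)

/-- A domain in `ℂⁿ`: a nonempty connected open set. -/
structure IsCDomain {n : ℕ} (D : Set (CSpace n)) : Prop where
  isOpen : IsOpen D
  isConnected : IsConnected D

/-- The set `{a + t b : t ∈ ℂ}`; it is a complex line when `b ≠ 0`. -/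
def complexLine {n : ℕ} (a b : CSpace n) : Set (CSpace n) :=
  {z | ∃ t : ℂ, z = a + t • b}

/-- A `ℂ`-convex domain: every (nonempty) intersection with a complex line is connected and simply
connected (`IsSimplyConnected` includes path connectedness and nonemptiness). -/
structure IsCConvexDomain {n : ℕ} (D : Set (CSpace n)) : Prop where
  isCDomain : IsCDomain D
  simplyConnected_inter : ∀ a b : CSpace n, b ≠ 0 →
    (D ∩ complexLine a b).Nonempty → IsSimplyConnected (D ∩ complexLine a b)

/-- `D` contains a complex line. -/
def ContainsComplexLine {n : ℕ} (D : Set (CSpace n)) : Prop :=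
  ∃ a b : CSpace n, b ≠ 0 ∧ complexLine a b ⊆ D

/-- `D` and `G` are biholomorphic: there are mutually inverse holomorphic maps between them. -/
def AreBiholomorphic {n : ℕ} (D G : Set (CSpace n)) : Prop :=
  ∃ f g : CSpace n → CSpace n,
    DifferentiableOn ℂ f D ∧ DifferentiableOn ℂ g G ∧ MapsTo f D G ∧ MapsTo g G D ∧
      LeftInvOn g f D ∧ RightInvOn g f G

/-- `S` is relatively compact in `D`. -/
def RelCompactIn {n : ℕ} (S D : Set (CSpace n)) : Prop :=
  IsCompact (closure S) ∧ closure S ⊆ D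

/-- The Möbius distance on the unit disc. -/
def moebiusDist (z w : ℂ) : ℝ :=
  ‖(z - w) / (1 - (starRingEnd ℂ) w * z)‖

/-- The Poincaré distance on the unit disc. -/
def poincareDist (z w : ℂ) : ℝ :=
  Real.artanh (moebiusDist z w)

/-- The Carathéodory (pseudo)distance `c_D`: the supremum of the Poincaré distances of
`f z` and `f w` over all holomorphic functions `f` from `D` to the unit disc. -/
def caratheodoryDist {n : ℕ} (D : Set (CSpace n)) (z w : CSpace n) : ℝ≥0∞ :=
  ⨆ (f : CSpace n → ℂ) (_ : DifferentiableOn ℂ f D ∧ MapsTo f D (ball (0 : ℂ) 1)),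
    ENNReal.ofReal (poincareDist (f z) (f w))

/-- `D` is `c`-finitely compact: all `c_D`-balls of finite radius are relatively compact in `D`. -/
def IsCFinitelyCompact {n : ℕ} (D : Set (CSpace n)) : Prop :=
  ∀ a ∈ D, ∀ r : ℝ, 0 < r →
    RelCompactIn {z | z ∈ D ∧ caratheodoryDist D a z < ENNReal.ofReal r} D

/-- `D` is `c`-complete: `c_D` separates the points of `D`, and each `c_D`-Cauchy sequence in `D`
converges (in the usual topology) to a point of `D`. -/
def IsCComplete {n : ℕ} (D : Set (CSpace n)) : Prop :=
  (∀ z ∈ D, ∀ w ∈ D, caratheodoryDist D z w = 0 → z = w) ∧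
  ∀ x : ℕ → CSpace n, (∀ j, x j ∈ D) →
    (∀ ε : ℝ, 0 < ε → ∃ N : ℕ, ∀ j ≥ N, ∀ k ≥ N,
      caratheodoryDist D (x j) (x k) < ENNReal.ofReal ε) →
    ∃ y ∈ D, Tendsto x atTop (𝓝 y)

/-- `u` is a continuous plurisubharmonic function on the open set `D`: it is continuous, and it
satisfies the sub-mean value inequality on each closed affine complex disc contained in `D`. -/
def ContPlurisubharmonicOn {n : ℕ} (u : CSpace n → ℝ) (D : Set (CSpace n)) : Prop :=
  ContinuousOn u D ∧
  ∀ a b : CSpace n, (∀ t ∈ closedBall (0 : ℂ) 1, a + t • b ∈ D) →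
    u a ≤ Real.circleAverage (fun t : ℂ => u (a + t • b)) 0 1

/-- `D` is hyperconvex: it has a negative continuous plurisubharmonic exhaustion function. -/
def IsHyperconvex {n : ℕ} (D : Set (CSpace n)) : Prop :=
  ∃ u : CSpace n → ℝ, ContPlurisubharmonicOn u D ∧ (∀ z ∈ D, u z < 0) ∧
    ∀ t : ℝ, 0 < t → RelCompactIn {z | z ∈ D ∧ u z < -t} D

/-- `D` is taut: the family of holomorphic maps from the unit disc to `D` is normal, that is, each
sequence of such maps has a subsequence that either converges locally uniformly to such a map or
diverges compactly. -/
def IsTaut {n : ℕ} (D : Set (CSpace n)) : Prop :=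
  ∀ φ : ℕ → ℂ → CSpace n,
    (∀ j, DifferentiableOn ℂ (φ j) (ball 0 1) ∧ MapsTo (φ j) (ball 0 1) D) →
    ∃ s : ℕ → ℕ, StrictMono s ∧
      ((∃ ψ : ℂ → CSpace n, DifferentiableOn ℂ ψ (ball 0 1) ∧ MapsTo ψ (ball 0 1) D ∧
          TendstoLocallyUniformlyOn (fun j => φ (s j)) ψ atTop (ball 0 1)) ∨
        (∀ K : Set ℂ, IsCompact K → K ⊆ ball 0 1 →
          ∀ L : Set (CSpace n), IsCompact L → L ⊆ D →
            ∀ᶠ j in atTop, Disjoint (φ (s j) '' K) L))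

end

/-! Everything follows from the abundance of linear functionals `ℓ` whose image `ℓ '' D` is a
proper, open, simply connected part of the plane. Composing such an `ℓ` with a Riemann map gives a
holomorphic map from `D` to the disc.

The geometric core is linear convexity: a point outside `D` lies on a complex hyperplane missing
`D`. Translate the point to 0 and take a maximal linear subspace `V` missing `D`. If `V` had
codimension at least 2, there would be a pencil of subspaces just above `V`, all meeting `D`, with
axis `V` disjoint from `D`. Its coordinates `x` and `y` would have continuous logarithms where they
do not vanish, because each member of the pencil cuts `D` in a set connected by simply connected
slices. Their difference would descend to a logarithm of `t = y / x` on the punctured plane, which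
is impossible (`pencil_axis_meets`). The same descent of logarithms gives `hasContinuousLogs_image`,
the only form of simple connectivity that the Riemann mapping theorem needs.

Since `D` contains no line, these functionals span the dual. A basis of them embeds `D` in a
polydisc. A bound `ρ < 1` on all disc maps vanishing at `a` confines every `ℓ z` to a compact part
of `ℓ '' D`, so it cuts out a relatively compact subset of `D` (`relCompactIn_discMap_le`).
Carathéodory balls are such sets, which gives finite compactness and then completeness. The supremum
`discMapSup` of those disc maps in norm, minus 1, is the exhaustion for hyperconvexity. The
Schwarz–Pick lemma controls `discMapSup` along holomorphic discs, so Montel's theorem yields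
tautness. -/

/-! ### Continuous logarithms along complex lines -/

theorem exp_eq_on_preconnected {α : Type*} [TopologicalSpace α] {S : Set α} (hS : IsPreconnected S)
    {f g : α → ℂ} (hf : ContinuousOn f S) (hg : ContinuousOn g S) {c : ℂ}
    (h : ∀ x ∈ S, Complex.exp (f x) = c * Complex.exp (g x)) {a b : α} (ha : a ∈ S) (hb : b ∈ S) :
    f a - g a = f b - g b := by
  have key : ∀ x ∈ S, Complex.exp (f x - g x) = c := by
    intro x hx
    rw [Complex.exp_sub, h x hx, mul_div_assoc, div_self (Complex.exp_ne_zero _), mul_one]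
  exact Complex.isCoveringMap_exp.constOn_of_comp (g := fun x => f x - g x) hS (hf.sub hg)
    (fun a ha b hb => Subtype.ext (by simp [key a ha, key b hb])) ha hb

theorem isSimplyConnected_univ {X : Type*} [TopologicalSpace X] [SimplyConnectedSpace X] :
    IsSimplyConnected (univ : Set X) := by
  have := (Homeomorph.refl X).isSimplyConnected_image (s := univ)
  exact (Homeomorph.Set.univ X).toHomotopyEquiv.simplyConnectedSpace_iff.mpr inferInstance

namespace IsCConvexDomain

variable {n : ℕ} {D : Set (CSpace n)}

/-- The set of parameters of points of `D` on the complex line through `p` and `q`. -/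
theorem isSimplyConnected_slice (hD : IsCConvexDomain D) {p : CSpace n} (hp : p ∈ D)
    (q : CSpace n) : IsSimplyConnected {τ : ℂ | p + τ • (q - p) ∈ D} := by
  by_cases hq : q - p = 0
  · simpa [hq, hp] using isSimplyConnected_univ (X := ℂ)
  have hinj : Topology.IsEmbedding (fun τ : ℂ => p + τ • (q - p)) :=
    (Homeomorph.addLeft p).isEmbedding.comp (isClosedEmbedding_smul_left hq).isEmbedding
  rw [← hinj.isSimplyConnected_image]
  have := hD.simplyConnected_inter p (q - p) hq ⟨p, hp, 0, by simp⟩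
  convert this using 1
  ext z
  simp only [mem_image, mem_ofPred_eq, mem_inter_iff, complexLine]
  constructor
  · rintro ⟨t, ht, rfl⟩; exact ⟨ht, t, rfl⟩
  · rintro ⟨hz, t, rfl⟩; exact ⟨t, hz, rfl⟩

theorem isOpen_slice (hD : IsCConvexDomain D) (p q : CSpace n) :
    IsOpen {τ : ℂ | p + τ • (q - p) ∈ D} :=
  hD.isCDomain.isOpen.preimage (f := fun τ : ℂ => p + τ • (q - p)) (by fun_prop)

/-- Logarithms of a nonvanishing function along the complex lines joining `z` to `σ z` depend
continuously on `z`. -/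
theorem exists_log_along_lines (hD : IsCConvexDomain D) {X : Set (CSpace n)} (hXD : X ⊆ D)
    {σ : CSpace n → CSpace n} (hσ : ContinuousOn σ X) (hσD : ∀ z ∈ X, σ z ∈ D)
    (hline : ∀ z ∈ X, ∀ τ : ℂ, σ z + τ • (z - σ z) ∈ D → σ z + τ • (z - σ z) ∈ X)
    {h : CSpace n → ℂ} (hc : ContinuousOn h X) (h0 : ∀ z ∈ X, h z ≠ 0) :
    ∃ g : CSpace n → ℂ, ContinuousOn g X ∧ ∀ z ∈ X, Complex.exp (g z) = h z / h (σ z) := by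
  have hlift : ∀ z ∈ X, ∃ f : ℂ → ℂ, ContinuousOn f {τ : ℂ | σ z + τ • (z - σ z) ∈ D} ∧
      ∀ τ : ℂ, σ z + τ • (z - σ z) ∈ D → Complex.exp (f τ) = h (σ z + τ • (z - σ z)) := by
    intro z hz
    obtain ⟨f, hf, hf'⟩ := Complex.exists_continuousOn_eqOn_exp_comp
      (g := fun τ : ℂ => h (σ z + τ • (z - σ z)))
      (hD.isSimplyConnected_slice (hσD z hz) z) (hD.isOpen_slice (σ z) z)
      (hc.comp (Continuous.continuousOn (by fun_prop)) fun τ hτ => hline z hz τ hτ)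
      (by rintro ⟨τ, hτ, h⟩; exact h0 _ (hline z hz τ hτ) h)
    exact ⟨f, hf, fun τ hτ => hf' hτ⟩
  choose! f hf hfe using hlift
  have hσX : ∀ z ∈ X, σ z ∈ X := fun z hz => by
    simpa using hline z hz 0 (by simpa using hσD z hz)
  -- The increment from `σ z` to `z` does not depend on which logarithm was chosen on the slice, so
  -- it can be continuous although `f z` is chosen separately for each `z`.
  refine ⟨fun z => f z 1 - f z 0, ?_, fun z hz => ?_⟩
  swap
  · rw [Complex.exp_sub, hfe z hz 1 (by simpa using hXD hz), hfe z hz 0 (by simpa using hσD z hz)]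
    simp
  rw [continuousOn_iff_continuous_domRestrict, continuous_iff_continuousAt]
  rintro ⟨z₀, hz₀⟩
  -- One path of parameters, chosen for `z₀`, also stays inside the slices of all nearby `z`.
  obtain ⟨γ, hγ⟩ : JoinedIn {τ : ℂ | σ z₀ + τ • (z₀ - σ z₀) ∈ D} 0 1 :=
    (hD.isSimplyConnected_slice (hσD z₀ hz₀) z₀).isPathConnected.joinedIn _
      (by simpa using hσD z₀ hz₀) _ (by simpa using hXD hz₀)
  have hσ' : Continuous fun z : X => σ z := continuousOn_iff_continuous_domRestrict.mp hσ
  set P : X → unitInterval → CSpace n := fun z t => σ z + γ t • ((z : CSpace n) - σ z) with hP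
  have hPc : Continuous fun q : X × unitInterval => P q.1 q.2 := by
    exact (hσ'.comp continuous_fst).add ((γ.continuous.comp continuous_snd).smul
      ((continuous_subtype_val.comp continuous_fst).sub (hσ'.comp continuous_fst)))
  -- `R` compares the normalized values of `h` along the two paths. It is 1 at `z₀`, hence in the
  -- slit plane for nearby `z`, uniformly in `t`, and there the principal logarithm measures the
  -- change of increment.
  set R : X → unitInterval → ℂ := fun z t =>
    h (P z t) / h (σ z) / (h (P ⟨z₀, hz₀⟩ t) / h (σ z₀)) with hR
  have hP0 : ∀ t, P ⟨z₀, hz₀⟩ t ∈ X := fun t => hline z₀ hz₀ _ (hγ t)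
  have hRc : ∀ q : X × unitInterval, P q.1 q.2 ∈ D →
      ContinuousAt (fun q : X × unitInterval => R q.1 q.2) q := by
    intro q hq
    have h1 : ContinuousAt (fun q : X × unitInterval => h (P q.1 q.2)) q := by
      have hev : ∀ᶠ q' in 𝓝 q, P q'.1 q'.2 ∈ X := by
        filter_upwards [hPc.continuousAt.eventually_mem (hD.isCDomain.isOpen.mem_nhds hq)]
          with q' hq' using hline _ q'.1.2 _ hq'
      exact Tendsto.comp (hc (P q.1 q.2) (hline _ q.1.2 _ hq))
        (tendsto_nhdsWithin_iff.mpr ⟨hPc.continuousAt, hev⟩)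
    have h2 : Continuous fun z : X => h (σ z) :=
      continuousOn_iff_continuous_domRestrict.mp (hc.comp hσ hσX)
    have h3 : Continuous fun t : unitInterval => h (P ⟨z₀, hz₀⟩ t) :=
      hc.comp_continuous (hPc.comp (Continuous.prodMk_right (⟨z₀, hz₀⟩ : X))) hP0
    refine (h1.div (h2.comp continuous_fst).continuousAt (h0 _ (hσX _ q.1.2))).div
      ((h3.comp continuous_snd).div_const _).continuousAt
      (div_ne_zero (h0 _ (hP0 _)) (h0 _ (hσX _ hz₀)))
  have hR1 : ∀ t, R ⟨z₀, hz₀⟩ t = 1 := fun t =>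
    div_self (div_ne_zero (h0 _ (hP0 _)) (h0 _ (hσX _ hz₀)))
  have hev : ∀ᶠ z : X in 𝓝 ⟨z₀, hz₀⟩, ∀ t ∈ (univ : Set unitInterval),
      P z t ∈ D ∧ R z t ∈ Complex.slitPlane := by
    refine isCompact_univ.eventually_forall_of_forall_eventually
      (P := fun z t => P z t ∈ D ∧ R z t ∈ Complex.slitPlane) fun t _ => ?_
    refine (hPc.continuousAt.eventually_mem (hD.isCDomain.isOpen.mem_nhds (hXD (hP0 t)))).and ?_
    refine (hRc (⟨z₀, hz₀⟩, t) (hXD (hP0 t))).eventually_mem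
      (Complex.isOpen_slitPlane.mem_nhds ?_)
    rw [hR1]; exact Complex.one_mem_slitPlane
  have hlim : Tendsto (fun z : X => f z₀ 1 - f z₀ 0 + Complex.log (R z 1)) (𝓝 ⟨z₀, hz₀⟩)
      (𝓝 (f z₀ 1 - f z₀ 0 + Complex.log 1)) := by
    refine tendsto_const_nhds.add (Tendsto.clog ?_ Complex.one_mem_slitPlane)
    rw [← hR1 1]
    exact (hRc (⟨z₀, hz₀⟩, 1) (hXD (hP0 1))).comp (f := fun z : X => (z, (1 : unitInterval)))
      (by fun_prop)
  rw [Complex.log_one, add_zero] at hlim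
  refine hlim.congr' ?_
  filter_upwards [hev] with z hz
  have hz' := fun t => hz t (mem_univ t)
  have hfγ : ∀ w : X, (∀ t, P w t ∈ D) → Continuous fun t => f w (γ t) := fun w hw =>
    (hf w w.2).comp_continuous γ.continuous hw
  have := exp_eq_on_preconnected (c := 1) (isPreconnected_univ (α := unitInterval))
    (f := fun t => f z (γ t) - f z 0)
    (g := fun t => f z₀ (γ t) - f z₀ 0 + Complex.log (R z t))
    ((hfγ z fun t => (hz' t).1).sub continuous_const).continuousOn
    (((hfγ ⟨z₀, hz₀⟩ fun t => hXD (hP0 t)).sub continuous_const).add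
      (continuous_iff_continuousAt.mpr fun t => ContinuousAt.clog
        ((hRc (z, t) (hz' t).1).comp (f := fun t : unitInterval => (z, t)) (by fun_prop))
        (hz' t).2)).continuousOn
    (fun t _ => by
      rw [one_mul, Complex.exp_add, Complex.exp_log (Complex.slitPlane_ne_zero (hz' t).2),
        Complex.exp_sub, Complex.exp_sub, hfe z z.2 _ (hz' t).1, hfe z₀ hz₀ _ (hγ t),
        hfe z z.2 0 (by simpa using hσD z z.2), hfe z₀ hz₀ 0 (by simpa using hσD z₀ hz₀)]
      have e1 := h0 _ (hP0 t)
      have e2 := h0 _ (hσX _ hz₀)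
      simp only [zero_smul, add_zero, hR]
      simp only [hP] at e1 ⊢
      field_simp)
    (mem_univ 0) (mem_univ 1)
  have hR0 : R z 0 = 1 := by
    simp [hR, hP, h0 _ (hσX _ hz₀), h0 _ (hσX _ z.2)]
  simp only [γ.source, γ.target, sub_self, hR0, Complex.log_one, add_zero] at this
  simp only [Set.domRestrict_apply]
  linear_combination this

end IsCConvexDomain

/-! ### Pencils of hyperplanes -/

namespace IsCConvexDomain

variable {n : ℕ} {D : Set (CSpace n)}

theorem sub_eq_sub_of_exp_eq_on_line (hD : IsCConvexDomain D) {p q : CSpace n} (hp : p ∈ D)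
    (hq : q ∈ D) {Y : Set (CSpace n)}
    (hY : ∀ τ : ℂ, p + τ • (q - p) ∈ D → p + τ • (q - p) ∈ Y) {f g : CSpace n → ℂ}
    (hf : ContinuousOn f Y) (hg : ContinuousOn g Y) {c : ℂ}
    (h : ∀ τ : ℂ, p + τ • (q - p) ∈ D →
      Complex.exp (f (p + τ • (q - p))) = c * Complex.exp (g (p + τ • (q - p)))) :
    f p - g p = f q - g q := by
  have hm : ContinuousOn (fun τ : ℂ => p + τ • (q - p)) {τ : ℂ | p + τ • (q - p) ∈ D} :=
    Continuous.continuousOn (by fun_prop)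
  have := exp_eq_on_preconnected
    (hD.isSimplyConnected_slice hp q).isPathConnected.isConnected.isPreconnected
    (hf.comp hm hY) (hg.comp hm hY) (c := c) h
    (a := 0) (b := 1) (by simpa using hp) (by simpa using hq)
  simpa using this

/-- Logarithms of a coordinate over an affine chart of the pencil of lines spanned by the
functionals `x` and `y`. -/
theorem exists_log_of_pencil (hD : IsCConvexDomain D) {W : Submodule ℂ (CSpace n)}
    {x y : CSpace n →L[ℂ] ℂ} {v : CSpace n} (hv : v ∈ W) (hxv : x v = 0) (hyv : y v = 1)
    (hne : ∀ z ∈ D, z ∈ W → x z = 0 → y z ≠ 0)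
    (hsurj : ∀ t : ℂ, ∃ z ∈ D, z ∈ W ∧ y z = t * x z) :
    ∃ g : CSpace n → ℂ, ContinuousOn g {z | z ∈ D ∧ z ∈ W ∧ x z ≠ 0} ∧
      ∀ z ∈ D, z ∈ W → x z ≠ 0 → Complex.exp (g z) = x z := by
  set X : Set (CSpace n) := {z | z ∈ D ∧ z ∈ W ∧ x z ≠ 0} with hX
  set p : CSpace n → ℂ := fun z => y z / x z with hp
  have hpc : ContinuousOn p X :=
    y.continuous.continuousOn.div x.continuous.continuousOn fun z hz => hz.2.2
  have hsurj' : ∀ t : ℂ, ∃ z ∈ X, p z = t := by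
    intro t
    obtain ⟨z, hzD, hzW, hz⟩ := hsurj t
    have hx : x z ≠ 0 := fun h => hne z hzD hzW h (by rw [hz, h, mul_zero])
    exact ⟨z, ⟨hzD, hzW, hx⟩, by simp only [hp]; rw [hz, mul_div_cancel_right₀ _ hx]⟩
  choose z₀ hz₀ hpz₀ using hsurj'
  have hyz₀ : ∀ t, y (z₀ t) = t * x (z₀ t) := fun t => by
    have : y (z₀ t) / x (z₀ t) = t := hpz₀ t
    rw [← div_eq_iff (hz₀ t).2.2, this]
  -- A local section of `p = y / x` through `z₀ t₀`: moving along `v` leaves `x` fixed and changes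
  -- only `y`.
  set s : ℂ → ℂ → CSpace n := fun t₀ t => z₀ t₀ + ((t - t₀) * x (z₀ t₀)) • v with hs
  have hsc : ∀ t₀, Continuous (s t₀) := fun t₀ => by simp only [hs]; fun_prop
  have hsW : ∀ t₀ t, s t₀ t ∈ W := fun t₀ t =>
    W.add_mem (hz₀ t₀).2.1 (W.smul_mem _ hv)
  have hxs : ∀ t₀ t, x (s t₀ t) = x (z₀ t₀) := fun t₀ t => by simp [hs, hxv]
  have hys : ∀ t₀ t, y (s t₀ t) = t * x (z₀ t₀) := fun t₀ t => by
    simp only [hs, map_add, map_smul, hyv, hyz₀, smul_eq_mul]; ring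
  have hps : ∀ t₀ t, p (s t₀ t) = t := fun t₀ t => by
    simp only [hp]; rw [hxs, hys, mul_div_cancel_right₀ _ (hz₀ t₀).2.2]
  have hss : ∀ t₀, s t₀ t₀ = z₀ t₀ := fun t₀ => by simp [hs]
  set U : ℂ → Set ℂ := fun t₀ => s t₀ ⁻¹' D with hU
  have hUo : ∀ t₀, IsOpen (U t₀) := fun t₀ => hD.isCDomain.isOpen.preimage (hsc t₀)
  have hUm : ∀ t₀, t₀ ∈ U t₀ := fun t₀ => by simp only [hU, mem_preimage, hss]; exact (hz₀ t₀).1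
  have hsX : ∀ t₀, ∀ t ∈ U t₀, s t₀ t ∈ X := fun t₀ t ht =>
    ⟨ht, hsW t₀ t, by rw [hxs]; exact (hz₀ t₀).2.2⟩
  -- A fibre of `p` is cut out by a linear equation, so it contains the whole slice of `D` by the
  -- line through two of its points.
  have hfib : ∀ a ∈ X, ∀ b ∈ X, p a = p b → ∀ τ : ℂ, a + τ • (b - a) ∈ D →
      a + τ • (b - a) ∈ X ∧ p (a + τ • (b - a)) = p a := by
    intro a ha b hb hab τ hτ
    have hWm : a + τ • (b - a) ∈ W :=
      W.add_mem ha.2.1 (W.smul_mem _ (W.sub_mem hb.2.1 ha.2.1))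
    have h1 : y a = p a * x a := by simp only [hp]; rw [div_mul_cancel₀ _ ha.2.2]
    have h2 : y b = p a * x b := by rw [hab]; simp only [hp]; rw [div_mul_cancel₀ _ hb.2.2]
    have h3 : y (a + τ • (b - a)) = p a * x (a + τ • (b - a)) := by
      simp only [map_add, map_smul, map_sub, h1, h2, smul_eq_mul]; ring
    have h4 : x (a + τ • (b - a)) ≠ 0 := fun h => hne _ hτ hWm h (by rw [h3, h, mul_zero])
    refine ⟨⟨hτ, hWm, h4⟩, ?_⟩
    change y _ / x _ = _
    rw [h3, mul_div_cancel_right₀ _ h4]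
  have hloc : ∀ t₀, ∃ g : CSpace n → ℂ, ContinuousOn g {z | z ∈ X ∧ p z ∈ U t₀} ∧
      ∀ z ∈ X, p z ∈ U t₀ → Complex.exp (g z) = x z := by
    intro t₀
    obtain ⟨g, hg, hge⟩ := hD.exists_log_along_lines (X := {z | z ∈ X ∧ p z ∈ U t₀})
      (fun z hz => hz.1.1) (σ := fun z => s t₀ (p z))
      ((hsc t₀).comp_continuousOn (hpc.mono fun z hz => hz.1)) (fun z hz => hz.2)
      (fun z hz τ hτ => by
        have := hfib _ (hsX t₀ _ hz.2) z hz.1 (hps _ _) τ hτ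
        exact ⟨this.1, by rw [this.2, hps]; exact hz.2⟩)
      x.continuous.continuousOn (fun z hz => hz.1.2.2)
    refine ⟨fun z => g z + Complex.log (x (z₀ t₀)), hg.add continuousOn_const, fun z hz hz' => ?_⟩
    rw [Complex.exp_add, hge z ⟨hz, hz'⟩, hxs, Complex.exp_log (hz₀ t₀).2.2,
      div_mul_cancel₀ _ (hz₀ t₀).2.2]
  choose g hg hge using hloc
  -- Two local logarithms of `x` differ by a constant on each fibre, so averaging them with weights
  -- depending only on `p` keeps the increments along fibres correct.
  obtain ⟨ρ, hρ⟩ := PartitionOfUnity.exists_isSubordinate (X := ℂ) isClosed_univ U hUo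
    (fun t _ => mem_iUnion.mpr ⟨t, hUm t⟩)
  set G : CSpace n → ℂ := fun z => ∑ᶠ i, (ρ i (p z) : ℂ) * g i z with hG
  have hpc' : Continuous fun z : X => p z := continuousOn_iff_continuous_domRestrict.mp hpc
  have hGc : ContinuousOn G X := by
    rw [continuousOn_iff_continuous_domRestrict]
    refine continuous_finsum (f := fun i (z : X) => (ρ i (p z) : ℂ) * g i z) (fun i => ?_) ?_
    · rw [continuous_iff_continuousAt]
      intro z
      by_cases hz : p z ∈ U i
      · have hgi : ContinuousAt (fun z : X => g i z) z := by
          have hev : ∀ᶠ z' : X in 𝓝 z, (z' : CSpace n) ∈ {z | z ∈ X ∧ p z ∈ U i} := by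
            filter_upwards [hpc'.continuousAt.eventually_mem ((hUo i).mem_nhds hz)] with z' hz'
              using ⟨z'.2, hz'⟩
          exact Tendsto.comp (hg i z ⟨z.2, hz⟩)
            (tendsto_nhdsWithin_iff.mpr ⟨continuous_subtype_val.continuousAt, hev⟩)
        exact (Complex.continuous_ofReal.comp ((ρ i).continuous.comp hpc')).continuousAt.mul hgi
      · have hz' : p z ∉ tsupport (ρ i) := fun h => hz (hρ i h)
        have : (fun z : X => (ρ i (p z) : ℂ) * g i z) =ᶠ[𝓝 z] fun _ => 0 := by
          filter_upwards [hpc'.continuousAt.eventually_mem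
            ((isClosed_tsupport (ρ i)).isOpen_compl.mem_nhds hz')] with z' hz''
          simp [image_eq_zero_of_notMem_tsupport hz'']
        exact (continuousAt_const (y := (0 : ℂ))).congr this.symm
    · refine (ρ.locallyFinite.preimage_continuous hpc').subset fun i z hz => ?_
      simp only [Function.mem_support, mem_preimage, ne_eq, mul_eq_zero, not_or] at hz ⊢
      exact_mod_cast hz.1
  have hGfib : ∀ a ∈ X, ∀ b ∈ X, p a = p b → Complex.exp (G a - G b) = x a / x b := by
    intro a ha b hb hab
    have hfin : ∀ z, (Function.support fun i => (ρ i (p z) : ℂ) * g i z).Finite := fun z =>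
      (ρ.locallyFinite.point_finite (p z)).subset fun i hi => by
        simp only [Function.mem_support, ne_eq, mul_eq_zero, not_or] at hi
        simpa using hi.1
    have hdiff : ∀ i, p a ∈ U i → g i a - g i b = g (p a) a - g (p a) b := by
      intro i hi
      have key := hD.sub_eq_sub_of_exp_eq_on_line ha.1 hb.1
        (Y := {z | z ∈ X ∧ p z = p a})
        (fun τ hτ => hfib a ha b hb hab τ hτ)
        ((hg i).mono fun z hz => ⟨hz.1, by rw [hz.2]; exact hi⟩)
        ((hg (p a)).mono fun z hz => ⟨hz.1, by rw [hz.2]; exact hUm _⟩) (c := 1)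
        (fun τ hτ => by
          obtain ⟨h1, h2⟩ := hfib a ha b hb hab τ hτ
          rw [one_mul, hge i _ h1 (by rw [h2]; exact hi), hge (p a) _ h1 (by rw [h2]; exact hUm _)])
      linear_combination key
    have hsum : G a - G b = g (p a) a - g (p a) b := by
      simp only [hG]
      rw [← finsum_sub_distrib (hfin a) (hfin b), ← hab]
      have h1 : ∀ i, (ρ i (p a) : ℂ) * g i a - (ρ i (p a) : ℂ) * g i b =
          (ρ i (p a) : ℂ) * (g (p a) a - g (p a) b) := by
        intro i
        by_cases hi : ρ i (p a) = 0
        · simp [hi]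
        · rw [← mul_sub, hdiff i (hρ i (subset_tsupport _ hi))]
      simp only [h1]
      rw [← finsum_mul' _ _ ((ρ.locallyFinite.point_finite (p a)).subset fun i hi => by
        simpa using hi)]
      have h2 : ∑ᶠ i, (ρ i (p a) : ℂ) = 1 := by
        have := ρ.sum_eq_one (mem_univ (p a))
        have h3 := Complex.ofRealHom.toAddMonoidHom.map_finsum
          (f := fun i => ρ i (p a)) (ρ.locallyFinite.point_finite (p a))
        rw [this] at h3
        simpa using h3.symm
      rw [h2, one_mul]
    rw [hsum, Complex.exp_sub, hge _ a ha (hUm _), hge _ b hb (by rw [← hab]; exact hUm _)]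
  -- The averaging error is a nonvanishing continuous function of `p` alone. It has a logarithm
  -- because `p` ranges over the simply connected plane.
  set K : ℂ → ℂ := fun t => x (z₀ t) / Complex.exp (G (z₀ t)) with hK
  have hKp : ∀ z ∈ X, x z / Complex.exp (G z) = K (p z) := by
    intro z hz
    have := hGfib z hz (z₀ (p z)) (hz₀ _) (hpz₀ _).symm
    rw [Complex.exp_sub] at this
    simp only [hK]
    have e1 := Complex.exp_ne_zero (G z)
    have e2 := Complex.exp_ne_zero (G (z₀ (p z)))
    have e3 := (hz₀ (p z)).2.2
    field_simp at this ⊢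
    linear_combination -this
  have hKc : Continuous K := by
    rw [continuous_iff_continuousAt]
    intro t₀
    have h1 : ContinuousOn (fun t => x (s t₀ t) / Complex.exp (G (s t₀ t))) (U t₀) :=
      (x.continuous.comp (hsc t₀)).continuousOn.div
        (Complex.continuous_exp.comp_continuousOn
          (hGc.comp (hsc t₀).continuousOn fun t ht => hsX t₀ t ht))
        fun _ _ => Complex.exp_ne_zero _
    refine (h1.continuousAt ((hUo t₀).mem_nhds (hUm t₀))).congr ?_
    filter_upwards [(hUo t₀).mem_nhds (hUm t₀)] with t ht
    rw [hKp _ (hsX t₀ t ht), hps]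
  obtain ⟨κ, hκ, hκe⟩ := Complex.exists_continuousOn_eqOn_exp_comp
    (isSimplyConnected_univ (X := ℂ)) isOpen_univ hKc.continuousOn (by
      rintro ⟨t, -, h⟩
      exact div_ne_zero (hz₀ t).2.2 (Complex.exp_ne_zero _) h)
  refine ⟨fun z => G z + κ (p z), hGc.add (hκ.comp hpc fun _ _ => mem_univ _),
    fun z h1 h2 h3 => ?_⟩
  have h4 : Complex.exp (κ (p z)) = K (p z) := hκe (mem_univ _)
  rw [Complex.exp_add, h4, ← hKp z ⟨h1, h2, h3⟩, mul_div_cancel₀ _ (Complex.exp_ne_zero _)]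

end IsCConvexDomain

theorem not_continuousOn_log_punctured_plane (L : ℂ → ℂ) (hL : ContinuousOn L {0}ᶜ)
    (h : ∀ t : ℂ, t ≠ 0 → Complex.exp (L t) = t) : False := by
  have hne : ∀ θ : ℝ, Complex.exp (θ * Complex.I) ∈ ({0}ᶜ : Set ℂ) := fun θ =>
    Complex.exp_ne_zero _
  have := exp_eq_on_preconnected (isPreconnected_univ (α := ℝ))
    (f := fun θ : ℝ => L (Complex.exp (θ * Complex.I))) (g := fun θ : ℝ => θ * Complex.I) (c := 1)
    (hL.comp (Continuous.continuousOn (by fun_prop)) fun θ _ => hne θ)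
    (Continuous.continuousOn (by fun_prop)) (fun θ _ => by rw [h _ (hne θ), one_mul])
    (mem_univ 0) (mem_univ (2 * Real.pi))
  simp only [Complex.ofReal_zero, zero_mul, Complex.exp_zero, Complex.ofReal_mul,
    Complex.ofReal_ofNat, Complex.exp_two_pi_mul_I] at this
  have h2 := Complex.two_pi_I_ne_zero
  exact h2 (by linear_combination this)

/-- Every nonvanishing continuous function on `U` has a continuous logarithm. -/
def HasContinuousLogs (U : Set ℂ) : Prop :=
  ∀ h : ℂ → ℂ, ContinuousOn h U → (∀ t ∈ U, h t ≠ 0) →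
    ∃ f : ℂ → ℂ, ContinuousOn f U ∧ ∀ t ∈ U, Complex.exp (f t) = h t

namespace IsCConvexDomain

variable {n : ℕ} {D : Set (CSpace n)}

/-- A pencil of complex hyperplanes (in a subspace `W`) whose members all meet a `ℂ`-convex domain
has an axis that meets the domain. -/
theorem pencil_axis_meets (hD : IsCConvexDomain D) {W : Submodule ℂ (CSpace n)}
    {x y : CSpace n →L[ℂ] ℂ} {u v : CSpace n} (hu : u ∈ W) (hv : v ∈ W)
    (hxu : x u = 1) (hyu : y u = 0) (hxv : x v = 0) (hyv : y v = 1)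
    (hne : ∀ z ∈ D, z ∈ W → x z = 0 → y z ≠ 0)
    (hsurj : ∀ α β : ℂ, (α ≠ 0 ∨ β ≠ 0) → ∃ z ∈ D, z ∈ W ∧ α * x z + β * y z = 0) : False := by
  obtain ⟨g₁, hg₁, hge₁⟩ := hD.exists_log_of_pencil hv hxv hyv hne (fun t => by
    obtain ⟨z, h1, h2, h3⟩ := hsurj (-t) 1 (Or.inr one_ne_zero)
    exact ⟨z, h1, h2, by linear_combination h3⟩)
  obtain ⟨g₂, hg₂, hge₂⟩ := hD.exists_log_of_pencil hu hyu hxu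
    (fun z h1 h2 h3 h4 => hne z h1 h2 h4 h3) (fun t => by
    obtain ⟨z, h1, h2, h3⟩ := hsurj 1 (-t) (Or.inl one_ne_zero)
    exact ⟨z, h1, h2, by linear_combination h3⟩)
  have hpt : ∀ t : ℂ, ∃ z ∈ D, z ∈ W ∧ x z ≠ 0 ∧ y z = t * x z := by
    intro t
    obtain ⟨z, h1, h2, h3⟩ := hsurj (-t) 1 (Or.inr one_ne_zero)
    have h4 : y z = t * x z := by linear_combination h3
    exact ⟨z, h1, h2, fun h => hne z h1 h2 h (by rw [h4, h, mul_zero]), h4⟩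
  choose z₀ hzD hzW hxz hyz using hpt
  -- On the fibre over `t` the difference `g₂ - g₁` is a continuous logarithm of the constant `t`,
  -- hence constant along slices, and any two points of the fibre share a slice.
  have hconst : ∀ t : ℂ, t ≠ 0 → ∀ z ∈ D, z ∈ W → x z ≠ 0 → y z = t * x z →
      g₂ z - g₁ z = g₂ (z₀ t) - g₁ (z₀ t) := by
    intro t ht z h1 h2 h3 h4
    have hmem : ∀ τ : ℂ, z + τ • (z₀ t - z) ∈ D → z + τ • (z₀ t - z) ∈ W ∧
        y (z + τ • (z₀ t - z)) = t * x (z + τ • (z₀ t - z)) ∧ x (z + τ • (z₀ t - z)) ≠ 0 := by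
      intro τ hτ
      have hW : z + τ • (z₀ t - z) ∈ W :=
        W.add_mem h2 (W.smul_mem _ (W.sub_mem (hzW t) h2))
      have hy : y (z + τ • (z₀ t - z)) = t * x (z + τ • (z₀ t - z)) := by
        simp only [map_add, map_smul, map_sub, h4, hyz, smul_eq_mul]; ring
      exact ⟨hW, hy, fun h => hne _ hτ hW h (by rw [hy, h, mul_zero])⟩
    exact hD.sub_eq_sub_of_exp_eq_on_line h1 (hzD t)
      (Y := {z | z ∈ D ∧ z ∈ W ∧ x z ≠ 0 ∧ y z ≠ 0})
      (fun τ hτ => by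
        obtain ⟨a, b, c⟩ := hmem τ hτ
        exact ⟨hτ, a, c, by rw [b]; exact mul_ne_zero ht c⟩)
      (hg₂.mono fun z hz => ⟨hz.1, hz.2.1, hz.2.2.2⟩)
      (hg₁.mono fun z hz => ⟨hz.1, hz.2.1, hz.2.2.1⟩) (c := t)
      (fun τ hτ => by
        obtain ⟨a, b, c⟩ := hmem τ hτ
        rw [hge₂ _ hτ a (by rw [b]; exact mul_ne_zero ht c), hge₁ _ hτ a c, b])
  refine not_continuousOn_log_punctured_plane (fun t => g₂ (z₀ t) - g₁ (z₀ t)) ?_ fun t ht => ?_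
  · intro t₀ ht₀
    refine ContinuousAt.continuousWithinAt ?_
    set s : ℂ → CSpace n := fun t => z₀ t₀ + ((t - t₀) * x (z₀ t₀)) • v with hs
    have hsc : Continuous s := by simp only [hs]; fun_prop
    have hxs : ∀ t, x (s t) = x (z₀ t₀) := fun t => by simp [hs, hxv]
    have hys : ∀ t, y (s t) = t * x (z₀ t₀) := fun t => by
      simp only [hs, map_add, map_smul, hyv, hyz, smul_eq_mul]; ring
    have hsW : ∀ t, s t ∈ W := fun t => W.add_mem (hzW t₀) (W.smul_mem _ hv)
    have hopen : IsOpen {t : ℂ | t ≠ 0 ∧ s t ∈ D} :=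
      isOpen_ne.inter (hD.isCDomain.isOpen.preimage hsc)
    have hmem : t₀ ∈ {t : ℂ | t ≠ 0 ∧ s t ∈ D} := ⟨ht₀, by simpa [hs] using hzD t₀⟩
    have hcont : ContinuousOn (fun t => g₂ (s t) - g₁ (s t)) {t : ℂ | t ≠ 0 ∧ s t ∈ D} :=
      (hg₂.comp hsc.continuousOn fun t ht => ⟨ht.2, hsW t, by
        rw [hys]; exact mul_ne_zero ht.1 (hxz _)⟩).sub
      (hg₁.comp hsc.continuousOn fun t ht => ⟨ht.2, hsW t, by rw [hxs]; exact hxz _⟩)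
    refine (hcont.continuousAt (hopen.mem_nhds hmem)).congr ?_
    filter_upwards [hopen.mem_nhds hmem] with t ht
    exact hconst t ht.1 _ ht.2 (hsW t) (by rw [hxs]; exact hxz _) (by rw [hys, hxs])
  · rw [Complex.exp_sub, hge₂ _ (hzD t) (hzW t) (by rw [hyz]; exact mul_ne_zero ht (hxz t)),
      hge₁ _ (hzD t) (hzW t) (hxz t), hyz, mul_div_cancel_right₀ _ (hxz t)]

/-- A maximal subspace missing `D` must be a hyperplane: otherwise a point `a` of `D` and a further
direction `v` span, modulo that subspace, a pencil excluded by `pencil_axis_meets`. -/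
theorem exists_functional_ne_zero (hD : IsCConvexDomain D) (h0 : (0 : CSpace n) ∉ D) :
    ∃ ℓ : CSpace n →L[ℂ] ℂ, ∀ z ∈ D, ℓ z ≠ 0 := by
  obtain ⟨V, hV, hmax⟩ := WellFounded.has_min
    (r := ((· > ·) : Submodule ℂ (CSpace n) → Submodule ℂ (CSpace n) → Prop)) wellFounded_gt
    {V | ∀ z ∈ D, z ∉ V} ⟨⊥, fun z hz h => h0 (by rwa [← (Submodule.mem_bot ℂ).mp h])⟩
  have hmeet : ∀ V' : Submodule ℂ (CSpace n), V < V' → ∃ z ∈ D, z ∈ V' := by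
    intro V' hlt
    by_contra! h
    exact hmax V' h hlt
  have hsep : ∀ (V' : Submodule ℂ (CSpace n)) (e : CSpace n), e ∉ V' →
      ∃ ℓ : CSpace n →L[ℂ] ℂ, ℓ e = 1 ∧ ∀ z ∈ V', ℓ z = 0 := by
    intro V' e he
    obtain ⟨f, hf, hle⟩ := Submodule.exists_le_ker_of_notMem he
    refine ⟨(f e)⁻¹ • LinearMap.toContinuousLinearMap f, ?_, fun z hz => ?_⟩
    · simp [hf]
    · have : f z = 0 := hle hz
      simp [this]
  obtain ⟨a, ha⟩ := hD.isCDomain.isConnected.nonempty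
  have hlt : ∀ e : CSpace n, e ∉ V → V < V ⊔ Submodule.span ℂ {e} := fun e he =>
    lt_of_le_of_ne le_sup_left fun h => he (by
      rw [h]; exact Submodule.mem_sup_right (Submodule.mem_span_singleton_self e))
  have hmem : ∀ (V' : Submodule ℂ (CSpace n)) (e z : CSpace n),
      z ∈ V' ⊔ Submodule.span ℂ {e} ↔ ∃ w ∈ V', ∃ c : ℂ, w + c • e = z := by
    intro V' e z
    simp only [Submodule.mem_sup, Submodule.mem_span_singleton]
    constructor
    · rintro ⟨w, hw, _, ⟨c, rfl⟩, h⟩; exact ⟨w, hw, c, h⟩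
    · rintro ⟨w, hw, c, h⟩; exact ⟨w, hw, _, ⟨c, rfl⟩, h⟩
  by_cases htop : V ⊔ Submodule.span ℂ {a} = ⊤
  · obtain ⟨ℓ, hℓ, hℓV⟩ := hsep V a (hV a ha)
    refine ⟨ℓ, fun z hz h => hV z hz ?_⟩
    obtain ⟨w, hw, c, rfl⟩ := (hmem V a z).mp (by rw [htop]; trivial)
    have : c = 0 := by simpa [hℓV w hw, hℓ] using h
    simpa [this] using hw
  exfalso
  obtain ⟨v, hv⟩ : ∃ v, v ∉ V ⊔ Submodule.span ℂ {a} := by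
    by_contra! h
    exact htop ((Submodule.eq_top_iff').mpr h)
  have haV : a ∉ V ⊔ Submodule.span ℂ {v} := by
    intro h
    obtain ⟨w, hw, c, hc⟩ := (hmem V v a).mp h
    rcases eq_or_ne c 0 with rfl | hc0
    · exact hV a ha (by rw [← hc]; simpa using hw)
    · refine hv ((hmem V a v).mpr ⟨-(c⁻¹ • w), V.neg_mem (V.smul_mem _ hw), c⁻¹, ?_⟩)
      rw [← hc, smul_add, inv_smul_smul₀ hc0]; abel
  obtain ⟨x, hx, hxV⟩ := hsep _ a haV
  obtain ⟨y, hy, hyV⟩ := hsep _ v hv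
  have hxV' : ∀ w ∈ V, x w = 0 := fun w hw => hxV w (Submodule.mem_sup_left hw)
  have hyV' : ∀ w ∈ V, y w = 0 := fun w hw => hyV w (Submodule.mem_sup_left hw)
  have hxv : x v = 0 := hxV v (Submodule.mem_sup_right (Submodule.mem_span_singleton_self v))
  have hya : y a = 0 := hyV a (Submodule.mem_sup_right (Submodule.mem_span_singleton_self a))
  set W := V ⊔ Submodule.span ℂ {a} ⊔ Submodule.span ℂ {v} with hW
  have haW : a ∈ W := Submodule.mem_sup_left
    (Submodule.mem_sup_right (Submodule.mem_span_singleton_self a))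
  have hvW : v ∈ W := Submodule.mem_sup_right (Submodule.mem_span_singleton_self v)
  have hVW : ∀ w ∈ V, w ∈ W := fun w hw => Submodule.mem_sup_left (Submodule.mem_sup_left hw)
  refine hD.pencil_axis_meets haW hvW hx hya hxv hy (fun z hz hzW hx0 hy0 => hV z hz ?_)
    fun α β hαβ => ?_
  · obtain ⟨w, hw, d, rfl⟩ := (hmem _ v z).mp hzW
    obtain ⟨w, hw', c, rfl⟩ := (hmem V a w).mp hw
    have hc : c = 0 := by simpa [hxV' w hw', hx, hxv] using hx0
    have hd : d = 0 := by simpa [hyV' w hw', hy, hya] using hy0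
    simpa [hc, hd] using hw'
  -- Modulo `V`, the member `α x + β y = 0` of the pencil is spanned by `e`; adding `e` to `V`
  -- enlarges it, so by maximality the result meets `D`.
  · set e := β • a - α • v with he
    have hxe : x e = β := by simp [he, hx, hxv]
    have hye : y e = -α := by simp [he, hy, hya]
    have heV : e ∉ V := by
      intro h
      rcases hαβ with h1 | h1
      · exact h1 (by have := hyV' e h; rw [hye] at this; simpa using this)
      · exact h1 (by rw [← hxe]; exact hxV' e h)
    obtain ⟨z, hz, hzV⟩ := hmeet _ (hlt e heV)
    obtain ⟨w, hw, c, rfl⟩ := (hmem V e z).mp hzV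
    refine ⟨_, hz, W.add_mem (hVW w hw) (W.smul_mem _ (W.sub_mem (W.smul_mem _ haW)
      (W.smul_mem _ hvW))), ?_⟩
    simp only [map_add, map_smul, hxV' w hw, hyV' w hw, hxe, hye, smul_eq_mul]
    ring

theorem preimage_add_right (hD : IsCConvexDomain D) (p : CSpace n) :
    IsCConvexDomain ((fun z => z + p) ⁻¹' D) := by
  set e := Homeomorph.addRight p
  have he : (fun z => z + p) ⁻¹' D = e ⁻¹' D := rfl
  rw [he]
  refine ⟨⟨hD.isCDomain.isOpen.preimage e.continuous, ?_⟩, fun a b hb hne => ?_⟩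
  · exact e.isConnected_preimage.mpr hD.isCDomain.isConnected
  · have hl : complexLine a b = e ⁻¹' complexLine (a + p) b := by
      ext z
      simp only [complexLine, mem_ofPred_eq, mem_preimage, e, Homeomorph.coe_addRight]
      refine exists_congr fun t => ?_
      rw [add_right_comm, add_left_inj]
    rw [hl, ← preimage_inter] at hne ⊢
    rw [Homeomorph.isSimplyConnected_preimage]
    refine hD.simplyConnected_inter _ _ hb ?_
    obtain ⟨z, hz⟩ := hne
    exact ⟨e z, hz⟩

/-- `ℂ`-convex domains are linearly convex. -/
theorem exists_functional_notMem_image (hD : IsCConvexDomain D) {p : CSpace n} (hp : p ∉ D) :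
    ∃ ℓ : CSpace n →L[ℂ] ℂ, ℓ p ∉ ℓ '' D := by
  obtain ⟨ℓ, hℓ⟩ := (hD.preimage_add_right p).exists_functional_ne_zero (by simpa using hp)
  refine ⟨ℓ, ?_⟩
  rintro ⟨z, hz, h⟩
  exact hℓ (z - p) (by simpa using hz) (by rw [map_sub, h, sub_self])

/-- Pull `h` back to `D` and take its logarithm along the lines through a fixed point. The pullback
is constant on the slice joining two points of a fibre of `ℓ`, so the logarithm is too, and it
descends to the image through affine local sections. -/
theorem hasContinuousLogs_image (hD : IsCConvexDomain D) {ℓ : CSpace n →L[ℂ] ℂ} (hℓ : ℓ ≠ 0) :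
    HasContinuousLogs (ℓ '' D) := by
  intro h hh hne
  obtain ⟨a, ha⟩ := hD.isCDomain.isConnected.nonempty
  have hhc : ContinuousOn (fun z => h (ℓ z)) D :=
    hh.comp ℓ.continuous.continuousOn fun z hz => mem_image_of_mem ℓ hz
  obtain ⟨g, hg, hge⟩ := hD.exists_log_along_lines (X := D) subset_rfl (σ := fun _ => a)
    continuousOn_const (fun _ _ => ha) (fun _ _ _ hτ => hτ) hhc
    (fun z hz => hne _ (mem_image_of_mem ℓ hz))
  obtain ⟨e, he⟩ : ∃ e, ℓ e = 1 := by
    obtain ⟨e, he⟩ : ∃ e, ℓ e ≠ 0 := by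
      by_contra! h
      exact hℓ (ContinuousLinearMap.ext h)
    exact ⟨(ℓ e)⁻¹ • e, by simp [he]⟩
  have hpt : ∀ t : ℂ, ∃ z, t ∈ ℓ '' D → z ∈ D ∧ ℓ z = t := by
    intro t
    by_cases ht : t ∈ ℓ '' D
    · obtain ⟨z, hz, rfl⟩ := ht; exact ⟨z, fun _ => ⟨hz, rfl⟩⟩
    · exact ⟨0, fun h => absurd h ht⟩
  choose z₀ hz₀ using hpt
  have hconst : ∀ z ∈ D, ∀ z' ∈ D, ℓ z = ℓ z' → g z = g z' := by
    intro z hz z' hz' hzz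
    have := hD.sub_eq_sub_of_exp_eq_on_line hz hz' (Y := D) (fun _ h => h) hg
      (continuousOn_const (c := 0)) (c := h (ℓ z) / h (ℓ a)) (fun τ hτ => by
        rw [hge _ hτ]; simp [hzz])
    simpa using this
  refine ⟨fun t => g (z₀ t) + Complex.log (h (ℓ a)), ?_, fun t ht => ?_⟩
  · intro t₀ ht₀
    refine ContinuousAt.continuousWithinAt (ContinuousAt.add ?_ continuousAt_const)
    set s : ℂ → CSpace n := fun t => z₀ t₀ + (t - t₀) • e with hs
    have hsc : Continuous s := by simp only [hs]; fun_prop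
    have hℓs : ∀ t, ℓ (s t) = t := fun t => by simp [hs, he, (hz₀ t₀ ht₀).2]
    have hev : ∀ᶠ t in 𝓝 t₀, s t ∈ D := hsc.continuousAt.eventually_mem
      (hD.isCDomain.isOpen.mem_nhds (by simpa [hs] using (hz₀ t₀ ht₀).1))
    have hgs : ContinuousAt (fun t => g (s t)) t₀ :=
      ContinuousAt.comp (g := g) (f := s) (hg.continuousAt (hD.isCDomain.isOpen.mem_nhds
        (by simpa [hs] using (hz₀ t₀ ht₀).1))) hsc.continuousAt
    refine hgs.congr ?_
    filter_upwards [hev] with t ht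
    have ht' : t ∈ ℓ '' D := ⟨s t, ht, hℓs t⟩
    exact hconst _ ht _ (hz₀ t ht').1 (by rw [hℓs, (hz₀ t ht').2])
  · have hha := hne _ (mem_image_of_mem ℓ ha)
    rw [Complex.exp_add, Complex.exp_log hha, hge _ (hz₀ t ht).1, div_mul_cancel₀ _ hha,
      (hz₀ t ht).2]

theorem isOpen_image (hD : IsCConvexDomain D) {ℓ : CSpace n →L[ℂ] ℂ} (hℓ : ℓ ≠ 0) :
    IsOpen (ℓ '' D) := by
  refine ℓ.isOpenMap (LinearMap.surjective ?_) _ hD.isCDomain.isOpen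
  intro h
  exact hℓ (ContinuousLinearMap.ext fun z => congr($h z))

end IsCConvexDomain

/-! ### Möbius maps and the Schwarz–Pick lemma -/

/-- The automorphism of the unit disc sending `b` to `0`. -/
noncomputable def moebiusMap (b z : ℂ) : ℂ := (z - b) / (1 - (starRingEnd ℂ) b * z)

theorem moebiusMap_denom_ne_zero {b z : ℂ} (hb : ‖b‖ < 1) (hz : ‖z‖ < 1) :
    1 - (starRingEnd ℂ) b * z ≠ 0 := by
  intro h
  have h1 : ‖(starRingEnd ℂ) b * z‖ = 1 := by rw [← sub_eq_zero.mp h, norm_one]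
  rw [norm_mul, RCLike.norm_conj] at h1
  nlinarith [norm_nonneg b, norm_nonneg z]

@[simp] theorem moebiusMap_self (b : ℂ) : moebiusMap b b = 0 := by simp [moebiusMap]

@[simp] theorem moebiusMap_zero_right (b : ℂ) : moebiusMap b 0 = -b := by simp [moebiusMap]

theorem one_sub_sq_norm_moebiusMap {b z : ℂ} (hb : ‖b‖ < 1) (hz : ‖z‖ < 1) :
    (1 - ‖moebiusMap b z‖ ^ 2) * ‖1 - (starRingEnd ℂ) b * z‖ ^ 2 =
      (1 - ‖z‖ ^ 2) * (1 - ‖b‖ ^ 2) := by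
  have hd := moebiusMap_denom_ne_zero hb hz
  rw [moebiusMap, norm_div, div_pow, sub_mul, div_mul_cancel₀ _ (by simpa using hd)]
  simp only [← Complex.normSq_eq_norm_sq, Complex.normSq_apply, Complex.sub_re, Complex.sub_im,
    Complex.mul_re, Complex.mul_im, Complex.one_re, Complex.one_im, Complex.conj_re,
    Complex.conj_im]
  ring

theorem norm_moebiusMap_lt_one {b z : ℂ} (hb : ‖b‖ < 1) (hz : ‖z‖ < 1) : ‖moebiusMap b z‖ < 1 := by
  have h := one_sub_sq_norm_moebiusMap hb hz
  have hd : 0 < ‖1 - (starRingEnd ℂ) b * z‖ ^ 2 := by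
    have := norm_pos_iff.mpr (moebiusMap_denom_ne_zero hb hz); positivity
  have h1 : 0 < (1 - ‖z‖ ^ 2) * (1 - ‖b‖ ^ 2) :=
    mul_pos (by nlinarith [norm_nonneg z]) (by nlinarith [norm_nonneg b])
  rw [← h] at h1
  have := (pos_iff_pos_of_mul_pos h1).mpr hd
  nlinarith [norm_nonneg (moebiusMap b z)]

theorem moebiusMap_neg_moebiusMap {b z : ℂ} (hb : ‖b‖ < 1) (hz : ‖z‖ < 1) :
    moebiusMap (-b) (moebiusMap b z) = z := by
  have hd := moebiusMap_denom_ne_zero hb hz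
  have hd' := moebiusMap_denom_ne_zero (b := -b) (by simpa using hb) (norm_moebiusMap_lt_one hb hz)
  have hq : moebiusMap b z * (1 - (starRingEnd ℂ) b * z) = z - b := div_mul_cancel₀ _ hd
  rw [moebiusMap, div_eq_iff hd', map_neg]
  linear_combination hq

theorem injOn_moebiusMap {b : ℂ} (hb : ‖b‖ < 1) : InjOn (moebiusMap b) (ball 0 1) := by
  intro z hz w hw h
  rw [← moebiusMap_neg_moebiusMap hb (mem_ball_zero_iff.mp hz), h,
    moebiusMap_neg_moebiusMap hb (mem_ball_zero_iff.mp hw)]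

theorem hasDerivAt_moebiusMap {b z : ℂ} (hb : ‖b‖ < 1) (hz : ‖z‖ < 1) :
    HasDerivAt (moebiusMap b)
      ((1 - (starRingEnd ℂ) b * b) / (1 - (starRingEnd ℂ) b * z) ^ 2) z := by
  have hd := moebiusMap_denom_ne_zero hb hz
  have := ((hasDerivAt_id z).sub_const b).div
    (((hasDerivAt_id z).const_mul ((starRingEnd ℂ) b)).const_sub 1) hd
  refine this.congr_deriv ?_
  simp only [id]
  congr 1
  ring

theorem differentiableOn_moebiusMap {b : ℂ} (hb : ‖b‖ < 1) :
    DifferentiableOn ℂ (moebiusMap b) (ball 0 1) := fun _ hz =>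
  (hasDerivAt_moebiusMap hb (mem_ball_zero_iff.mp hz)).differentiableAt.differentiableWithinAt

theorem mapsTo_moebiusMap {b : ℂ} (hb : ‖b‖ < 1) :
    MapsTo (moebiusMap b) (ball 0 1) (ball 0 1) := fun _ hz =>
  mem_ball_zero_iff.mpr (norm_moebiusMap_lt_one hb (mem_ball_zero_iff.mp hz))

/-- The **Schwarz–Pick lemma**. -/
theorem norm_moebiusMap_le_of_mapsTo {f : ℂ → ℂ} (hf : DifferentiableOn ℂ f (ball 0 1))
    (hm : MapsTo f (ball 0 1) (ball 0 1)) {z w : ℂ} (hz : ‖z‖ < 1) (hw : ‖w‖ < 1) :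
    ‖moebiusMap (f w) (f z)‖ ≤ ‖moebiusMap w z‖ := by
  have hfw : ‖f w‖ < 1 := mem_ball_zero_iff.mp (hm (mem_ball_zero_iff.mpr hw))
  have hw' : ‖-w‖ < 1 := by simpa using hw
  -- Conjugating by disc automorphisms moves `w` and `f w` to 0, where the Schwarz lemma applies.
  have h := Complex.norm_le_norm_of_mapsTo_ball
    (f := fun ζ => moebiusMap (f w) (f (moebiusMap (-w) ζ))) (z := moebiusMap w z) (R := 1)
    ((differentiableOn_moebiusMap hfw).comp (hf.comp (differentiableOn_moebiusMap hw')
      (mapsTo_moebiusMap hw')) (hm.comp (mapsTo_moebiusMap hw')))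
    (((mapsTo_moebiusMap hfw).comp (hm.comp (mapsTo_moebiusMap hw'))).mono_right
      ball_subset_closedBall) (by simp) (norm_moebiusMap_lt_one hw hz)
  rwa [moebiusMap_neg_moebiusMap hw hz] at h

/-- A bound on `‖z‖` in terms of `‖b‖` and the Möbius distance of `z` and `b`. -/
theorem sq_norm_le_of_moebiusMap_le {b z : ℂ} {m ρ : ℝ} (hbρ : ‖b‖ ≤ ρ) (hρ : ρ < 1)
    (hz : ‖z‖ < 1) (hm : ‖moebiusMap b z‖ ≤ m) (hm1 : m < 1) :
    ‖z‖ ^ 2 ≤ 1 - (1 - m ^ 2) * (1 - ρ) ^ 2 := by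
  have hb : ‖b‖ < 1 := hbρ.trans_lt hρ
  have h := one_sub_sq_norm_moebiusMap hb hz
  have h1 : 1 - ρ ≤ ‖1 - (starRingEnd ℂ) b * z‖ := by
    have h2 := norm_sub_norm_le 1 ((starRingEnd ℂ) b * z)
    rw [norm_one, norm_mul, RCLike.norm_conj] at h2
    nlinarith [norm_nonneg b, norm_nonneg z]
  have h0 := norm_nonneg (moebiusMap b z)
  have h3 : (1 - m ^ 2) * (1 - ρ) ^ 2 ≤ (1 - ‖moebiusMap b z‖ ^ 2) *
      ‖1 - (starRingEnd ℂ) b * z‖ ^ 2 := by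
    gcongr
    · nlinarith
  have h4 : (1 - ‖z‖ ^ 2) * (1 - ‖b‖ ^ 2) ≤ 1 - ‖z‖ ^ 2 := by
    nlinarith [norm_nonneg b, norm_nonneg z, mul_nonneg (by nlinarith [norm_nonneg z] :
      0 ≤ 1 - ‖z‖ ^ 2) (sq_nonneg ‖b‖)]
  linarith

/-! ### Normal families, inverse functions and Hurwitz's theorem -/

/-- Arzelà–Ascoli in a form that needs no separate closedness check: the pointwise and local
Lipschitz bounds survive pointwise limits and force continuity, so the family is closed in a product
of closed balls. -/
theorem isCompact_equicontinuous_family {X F : Type*} [MetricSpace X] [NormedAddCommGroup F]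
    [ProperSpace F] (M r L : X → ℝ) (hr : ∀ x, 0 < r x) :
    IsCompact {f : C(X, F) | ∀ x, ‖f x‖ ≤ M x ∧
      ∀ y, dist y x < r x → dist (f y) (f x) ≤ L x * dist y x} := by
  have hlim : ∀ x, Tendsto (fun y => L x * dist y x) (𝓝 x) (𝓝 0) := by
    intro x
    have : Continuous fun y => L x * dist y x := by fun_prop
    simpa using this.tendsto x
  apply ArzelaAscoli.isCompact_of_equicontinuous
  · have hS : ContinuousMap.toFun '' {f : C(X, F) | ∀ x, ‖f x‖ ≤ M x ∧
        ∀ y, dist y x < r x → dist (f y) (f x) ≤ L x * dist y x} =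
        (univ.pi fun x => closedBall (0 : F) (M x)) ∩
          {f : X → F | ∀ x, ∀ y, dist y x < r x → dist (f y) (f x) ≤ L x * dist y x} := by
      ext f
      constructor
      · rintro ⟨f, hf, rfl⟩
        exact ⟨fun x _ => mem_closedBall_zero_iff.mpr (hf x).1, fun x => (hf x).2⟩
      · rintro ⟨h1, h2⟩
        refine ⟨⟨f, continuous_iff_continuousAt.mpr fun x => ?_⟩, fun x =>
          ⟨mem_closedBall_zero_iff.mp (h1 x trivial), h2 x⟩, rfl⟩
        refine tendsto_iff_dist_tendsto_zero.mpr (squeeze_zero' (.of_forall fun _ => dist_nonneg)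
          ?_ (hlim x))
        filter_upwards [ball_mem_nhds x (hr x)] with y hy using h2 x y hy
    rw [hS]
    refine (isCompact_univ_pi fun x => isCompact_closedBall _ _).inter_right ?_
    simp only [ofPred_forall]
    refine isClosed_iInter fun x => isClosed_iInter fun y => isClosed_iInter fun _ =>
      isClosed_le ?_ continuous_const
    exact (continuous_apply y).dist (continuous_apply x)
  · intro x
    rw [Metric.equicontinuousAt_iff_right]
    intro ε hε
    filter_upwards [ball_mem_nhds x (hr x), (hlim x).eventually_lt_const hε] with y hy hy' f
    rw [dist_comm]
    exact ((f.2 x).2 y hy).trans_lt hy'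

/-- **Montel's theorem**. -/
theorem exists_subseq_tendstoLocallyUniformlyOn {F : Type*} [NormedAddCommGroup F]
    [NormedSpace ℂ F] [ProperSpace F] {U : Set ℂ} (hU : IsOpen U) {f : ℕ → ℂ → F}
    (hf : ∀ j, DifferentiableOn ℂ (f j) U)
    (hb : ∀ z ∈ U, ∃ r > 0, ∃ M : ℝ, ∀ j, ∀ w ∈ ball z r, w ∈ U → ‖f j w‖ ≤ M) :
    ∃ s : ℕ → ℕ, StrictMono s ∧ ∃ g : ℂ → F, DifferentiableOn ℂ g U ∧
      TendstoLocallyUniformlyOn (fun j => f (s j)) g atTop U := by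
  have hb' : ∀ z : U, ∃ r > 0, ball (z : ℂ) r ⊆ U ∧ ∃ M : ℝ, 0 ≤ M ∧
      ∀ j, ∀ w ∈ ball (z : ℂ) r, ‖f j w‖ ≤ M := by
    rintro ⟨z, hz⟩
    obtain ⟨r, hr, M, hM⟩ := hb z hz
    obtain ⟨r', hr', hrU⟩ := Metric.isOpen_iff.mp hU z hz
    refine ⟨min r r', lt_min hr hr', (ball_subset_ball (min_le_right _ _)).trans hrU, M,
      (norm_nonneg _).trans (hM 0 z (mem_ball_self hr) hz), fun j w hw => ?_⟩
    exact hM j w (ball_subset_ball (min_le_left _ _) hw)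
      (hrU (ball_subset_ball (min_le_right _ _) hw))
  choose r hr hrU M hM0 hM using hb'
  have hK := isCompact_equicontinuous_family (F := F) M r (fun x => 2 * M x / r x) hr
  set φ : ℕ → C(U, F) := fun j =>
    ⟨U.domRestrict (f j), continuousOn_iff_continuous_domRestrict.mp (hf j).continuousOn⟩ with hφ
  have hmem : ∀ j, φ j ∈ {f : C(U, F) | ∀ x, ‖f x‖ ≤ M x ∧
      ∀ y, dist y x < r x → dist (f y) (f x) ≤ 2 * M x / r x * dist y x} := by
    intro j x
    refine ⟨hM x j x (mem_ball_self (hr x)), fun y hy => ?_⟩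
    refine Complex.dist_le_div_mul_dist_of_mapsTo_ball (f := f j) ((hf j).mono (hrU x))
      (fun w hw => ?_) hy
    rw [mem_closedBall, dist_eq_norm, two_mul]
    exact (norm_sub_le _ _).trans (add_le_add (hM x j w hw) (hM x j x (mem_ball_self (hr x))))
  have : LocallyCompactSpace U := hU.locallyCompactSpace
  obtain ⟨g, -, s, hs, hlim⟩ := hK.tendsto_subseq hmem
  have hlim' : TendstoLocallyUniformlyOn (fun j => f (s j)) (Function.extend (↑) g 0) atTop U := by
    rw [tendstoLocallyUniformlyOn_iff_tendstoLocallyUniformly_comp_coe]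
    have h := ContinuousMap.tendsto_iff_tendstoLocallyUniformly.mp hlim
    rw [Function.extend_comp Subtype.val_injective]
    exact h
  exact ⟨s, hs, _, hlim'.differentiableOn (.of_forall fun j => hf _) hU, hlim'⟩

theorem not_eventually_eq_of_injOn {U : Set ℂ} (hU : IsOpen U) {f : ℂ → ℂ} (hi : InjOn f U)
    {z : ℂ} (hz : z ∈ U) (c : ℂ) : ¬ ∀ᶠ w in 𝓝 z, f w = c := by
  intro h
  have h2 : ∀ᶠ w in 𝓝 z, f w = c ∧ w ∈ U := h.and (hU.mem_nhds hz)
  have h3 : ∀ᶠ w in 𝓝[≠] z, w = z := by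
    filter_upwards [h2.filter_mono nhdsWithin_le_nhds] with w hw
    exact hi hw.2 hz (hw.1.trans h.self_of_nhds.symm)
  obtain ⟨w, hw, hw'⟩ := (h3.and self_mem_nhdsWithin).exists
  exact hw' hw

theorem nhds_le_map_nhds_of_injOn {U : Set ℂ} (hU : IsOpen U) {f : ℂ → ℂ}
    (hf : DifferentiableOn ℂ f U) (hi : InjOn f U) {z : ℂ} (hz : z ∈ U) :
    𝓝 (f z) ≤ map f (𝓝 z) := by
  refine ((hf.analyticAt (hU.mem_nhds hz)).eventually_constant_or_nhds_le_map_nhds).resolve_left ?_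
  exact not_eventually_eq_of_injOn hU hi hz _

theorem isOpen_image_of_injOn {U : Set ℂ} (hU : IsOpen U) {f : ℂ → ℂ}
    (hf : DifferentiableOn ℂ f U) (hi : InjOn f U) : IsOpen (f '' U) := by
  rw [isOpen_iff_mem_nhds]
  rintro _ ⟨z, hz, rfl⟩
  exact nhds_le_map_nhds_of_injOn hU hf hi hz (image_mem_map (hU.mem_nhds hz))

/-- The inverse of an injective holomorphic function is holomorphic. -/
theorem differentiableOn_of_leftInvOn {U : Set ℂ} (hU : IsOpen U) {f g : ℂ → ℂ}
    (hf : DifferentiableOn ℂ f U) (hg : LeftInvOn g f U) : DifferentiableOn ℂ g (f '' U) := by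
  have hi := hg.injOn
  have hgc : ∀ z ∈ U, ContinuousAt g (f z) := by
    intro z hz
    change map g (𝓝 (f z)) ≤ 𝓝 (g (f z))
    rw [hg hz]
    intro N hN
    have h1 := nhds_le_map_nhds_of_injOn hU hf hi hz
      (image_mem_map (inter_mem hN (hU.mem_nhds hz)))
    refine mem_map.mpr (mem_of_superset h1 ?_)
    rintro _ ⟨w, hw, rfl⟩
    rw [mem_preimage, hg hw.2]; exact hw.1
  have hopen := isOpen_image_of_injOn hU hf hi
  rintro _ ⟨z, hz, rfl⟩
  -- Critical points are isolated, so `g` is differentiable on a punctured neighbourhood of `f z`;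
  -- being continuous there, it extends analytically across the point.
  have hd : ∀ᶠ w in 𝓝[≠] z, deriv f w ≠ 0 := by
    refine ((hf.analyticAt (hU.mem_nhds hz)).deriv.eventually_eq_zero_or_eventually_ne_zero).resolve_left
      fun h => ?_
    obtain ⟨r, hr, hrz⟩ := Metric.eventually_nhds_iff_ball.mp (h.and (hU.mem_nhds hz))
    refine not_eventually_eq_of_injOn hU hi hz (f z) ?_
    filter_upwards [ball_mem_nhds z hr] with w hw
    exact isOpen_ball.is_const_of_deriv_eq_zero (convex_ball z r).isPreconnected
      (hf.mono fun w hw => (hrz w hw).2) (fun w hw => (hrz w hw).1) hw (mem_ball_self hr)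
  refine AnalyticAt.differentiableWithinAt
    (Complex.analyticAt_of_differentiable_on_punctured_nhds_of_continuousAt ?_ (hgc z hz))
  have hgt : Tendsto g (𝓝[≠] (f z)) (𝓝[≠] z) := by
    refine tendsto_nhdsWithin_iff.mpr ⟨?_, ?_⟩
    · have := (hgc z hz).tendsto
      rw [hg hz] at this
      exact this.mono_left nhdsWithin_le_nhds
    · filter_upwards [self_mem_nhdsWithin, nhdsWithin_le_nhds (hopen.mem_nhds ⟨z, hz, rfl⟩)]
      rintro _ hw ⟨w, hwU, rfl⟩
      rw [hg hwU]
      rintro rfl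
      exact hw rfl
  filter_upwards [hgt.eventually hd, nhdsWithin_le_nhds (hopen.mem_nhds ⟨z, hz, rfl⟩)]
  rintro _ hw ⟨w, hwU, rfl⟩
  refine (HasDerivAt.of_local_left_inverse (f := f) (hgc w hwU) (f' := deriv f (g (f w))) ?_ hw
    ?_).differentiableAt
  · rw [hg hwU]; exact (hf.differentiableAt (hU.mem_nhds hwU)).hasDerivAt
  · filter_upwards [hopen.mem_nhds ⟨w, hwU, rfl⟩]
    rintro _ ⟨w', hw', rfl⟩
    rw [hg hw']

theorem deriv_ne_zero_of_injOn {U : Set ℂ} (hU : IsOpen U) {f : ℂ → ℂ}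
    (hf : DifferentiableOn ℂ f U) (hi : InjOn f U) {z : ℂ} (hz : z ∈ U) : deriv f z ≠ 0 := by
  intro h
  have hg : LeftInvOn (Function.invFunOn f U) f U := hi.leftInvOn_invFunOn
  have hgd := (differentiableOn_of_leftInvOn hU hf hg).differentiableAt
    ((isOpen_image_of_injOn hU hf hi).mem_nhds ⟨z, hz, rfl⟩)
  have h1 := hgd.hasDerivAt.comp z (hf.differentiableAt (hU.mem_nhds hz)).hasDerivAt
  rw [h, mul_zero] at h1
  have h2 : HasDerivAt (Function.invFunOn f U ∘ f) 1 z := (hasDerivAt_id z).congr_of_eventuallyEq (by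
    filter_upwards [hU.mem_nhds hz] with w hw using hg hw)
  exact zero_ne_one (h1.unique h2)

/-- **Hurwitz's theorem** for injective functions. -/
theorem injOn_of_tendstoLocallyUniformlyOn {U : Set ℂ} (hU : IsOpen U) (hUc : IsPreconnected U)
    {F : ℕ → ℂ → ℂ} {f : ℂ → ℂ} (hF : ∀ j, DifferentiableOn ℂ (F j) U)
    (hi : ∀ j, InjOn (F j) U) (hlim : TendstoLocallyUniformlyOn F f atTop U)
    (hne : ∀ c, ¬ ∀ z ∈ U, f z = c) : InjOn f U := by
  have hf : DifferentiableOn ℂ f U := hlim.differentiableOn (.of_forall hF) hU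
  intro z₁ h₁ z₂ h₂ heq
  by_contra hz
  have hisol : ∀ᶠ w in 𝓝[≠] z₂, f w - f z₁ ≠ 0 := by
    have han : AnalyticOnNhd ℂ (fun w => f w - f z₁) U := (hf.sub_const _).analyticOnNhd hU
    refine (han z₂ h₂).eventually_eq_zero_or_eventually_ne_zero.resolve_left fun h => ?_
    refine hne (f z₁) fun z hz => sub_eq_zero.mp ?_
    exact han.eqOn_zero_of_preconnected_of_eventuallyEq_zero hUc h₂ h hz
  rw [eventually_nhdsWithin_iff] at hisol
  obtain ⟨r, hr, hrz⟩ := Metric.nhds_basis_closedBall.eventually_iff.mp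
    ((hisol.and (hU.mem_nhds h₂)).and (isOpen_ne.mem_nhds (Ne.symm hz)))
  have hsub : closedBall z₂ r ⊆ U := fun w hw => (hrz hw).1.2
  obtain ⟨w₀, hw₀, hmin⟩ := (isCompact_sphere z₂ r).exists_isMinOn
    (NormedSpace.sphere_nonempty.mpr hr.le)
    (((hf.continuousOn.mono (sphere_subset_closedBall.trans hsub)).sub
      (continuousOn_const (c := f z₁))).norm)
  set δ := ‖f w₀ - f z₁‖ with hδ
  have hδ0 : 0 < δ := norm_pos_iff.mpr ((hrz (sphere_subset_closedBall hw₀)).1.1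
    (ne_of_mem_sphere hw₀ hr.ne'))
  have hunif : ∀ᶠ j in atTop, ∀ w ∈ closedBall z₂ r, dist (f w) (F j w) < δ / 4 :=
    Metric.tendstoUniformlyOn_iff.mp
      ((tendstoLocallyUniformlyOn_iff_forall_isCompact hU).mp hlim _ hsub
        (isCompact_closedBall _ _)) _ (by positivity)
  have hpt : ∀ᶠ j in atTop, dist (F j z₁) (f z₁) < δ / 4 :=
    Metric.tendsto_nhds.mp (hlim.tendsto_at h₁) _ (by positivity)
  obtain ⟨j, hj1, hj2⟩ := (hunif.and hpt).exists
  -- Injectivity makes this difference zero-free on a disc avoiding `z₁`. On the boundary circle it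
  -- is at least `δ - δ/4 - δ/4 = δ/2`, so the maximum principle for its reciprocal gives the same
  -- bound at `z₂`, where it is in fact smaller since `f z₁ = f z₂`.
  have hG0 : ∀ w ∈ closedBall z₂ r, F j w - F j z₁ ≠ 0 := fun w hw h =>
    (hrz hw).2 (hi j (hsub hw) h₁ (sub_eq_zero.mp h))
  have hmax := Complex.norm_le_of_forall_mem_frontier_norm_le (U := ball z₂ r)
    (f := fun w => (F j w - F j z₁)⁻¹) (C := 2 / δ) isBounded_ball
    (DifferentiableOn.diffContOnCl (by
      rw [closure_ball _ hr.ne']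
      exact (((hF j).mono hsub).sub_const _).inv hG0))
    (fun w hw => by
      rw [frontier_ball _ hr.ne'] at hw
      have e1 : δ ≤ ‖f w - f z₁‖ := hmin hw
      have e2 := hj1 w (sphere_subset_closedBall hw)
      rw [dist_eq_norm] at e2 hj2
      have e3 : ‖f w - f z₁‖ ≤ ‖f w - F j w‖ + ‖F j w - F j z₁‖ + ‖F j z₁ - f z₁‖ := by
        have : f w - f z₁ = (f w - F j w) + (F j w - F j z₁) + (F j z₁ - f z₁) := by ring
        rw [this]; exact norm_add₃_le
      rw [norm_inv, inv_le_comm₀ (norm_pos_iff.mpr (hG0 w (sphere_subset_closedBall hw)))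
        (by positivity), inv_div]
      linarith)
    (subset_closure (mem_ball_self hr))
  have hz2 : z₂ ∈ closedBall z₂ r := mem_closedBall_self hr.le
  rw [norm_inv, inv_le_comm₀ (norm_pos_iff.mpr (hG0 _ hz2)) (by positivity), inv_div] at hmax
  have e2 := hj1 _ hz2
  rw [dist_eq_norm] at e2 hj2
  have e3 : ‖F j z₂ - F j z₁‖ ≤ ‖f z₂ - F j z₂‖ + ‖F j z₁ - f z₁‖ := by
    have : F j z₂ - F j z₁ = -((f z₂ - F j z₂) + (F j z₁ - f z₁)) := by rw [heq]; ring
    rw [this, norm_neg]; exact norm_add_le _ _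
  linarith

/-! ### The Riemann mapping theorem -/

/-- Near `z` the increment of `f` has imaginary part below π in absolute value, so it is the
principal logarithm of `h w / h z`. -/
theorem differentiableOn_of_exp_eq {U : Set ℂ} (hU : IsOpen U) {f h : ℂ → ℂ}
    (hf : ContinuousOn f U) (hh : DifferentiableOn ℂ h U)
    (he : ∀ z ∈ U, Complex.exp (f z) = h z) : DifferentiableOn ℂ f U := by
  intro z hz
  have h0 : h z ≠ 0 := by rw [← he z hz]; exact Complex.exp_ne_zero _
  have hd : DifferentiableAt ℂ (fun w => Complex.log (h w / h z) + f z) z := by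
    refine (DifferentiableAt.clog ((hh.differentiableAt (hU.mem_nhds hz)).div_const _) ?_).add_const _
    rw [div_self h0]; exact Complex.one_mem_slitPlane
  refine (hd.congr_of_eventuallyEq ?_).differentiableWithinAt
  filter_upwards [hU.mem_nhds hz,
    (hf.continuousAt (hU.mem_nhds hz)).eventually_mem (ball_mem_nhds (f z) one_pos)] with w hw hw'
  rw [mem_ball, dist_eq_norm] at hw'
  have him := (Complex.abs_im_le_norm (f w - f z)).trans_lt hw'
  rw [abs_lt] at him
  have hpi := Real.pi_gt_three
  rw [← he w hw, ← he z hz, ← Complex.exp_sub, Complex.log_exp (by linarith) (by linarith)]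
  ring

/-- Injective holomorphic maps of `U` to the unit disc that vanish at `a`. -/
structure IsDiscEmbedding (U : Set ℂ) (a : ℂ) (f : ℂ → ℂ) : Prop where
  differentiableOn : DifferentiableOn ℂ f U
  mapsTo : MapsTo f U (ball 0 1)
  injOn : InjOn f U
  map_zero : f a = 0

namespace HasContinuousLogs

variable {U : Set ℂ}

theorem exists_sqrt (hL : HasContinuousLogs U) (hU : IsOpen U) {h : ℂ → ℂ}
    (hh : DifferentiableOn ℂ h U) (h0 : ∀ z ∈ U, h z ≠ 0) :
    ∃ s : ℂ → ℂ, DifferentiableOn ℂ s U ∧ ∀ z ∈ U, s z ^ 2 = h z ∧ s z ≠ 0 := by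
  obtain ⟨f, hf, he⟩ := hL h hh.continuousOn h0
  refine ⟨fun z => Complex.exp (f z / 2),
    ((differentiableOn_of_exp_eq hU hf hh he).div_const 2).cexp, fun z hz =>
      ⟨?_, Complex.exp_ne_zero _⟩⟩
  rw [← Complex.exp_nat_mul, ← he z hz]
  congr 1
  push_cast; ring

/-- A square root of `z - q` never takes two opposite values. Its image contains a disc about `s a`,
hence misses the disc about `-s a`, and inversion in that disc bounds it. -/
theorem exists_isDiscEmbedding (hL : HasContinuousLogs U) (hU : IsOpen U) (hne : U ≠ univ)
    {a : ℂ} (ha : a ∈ U) : ∃ f, IsDiscEmbedding U a f := by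
  obtain ⟨q, hq⟩ := (ne_univ_iff_exists_notMem U).mp hne
  obtain ⟨s, hs, hs2⟩ := hL.exists_sqrt hU (h := fun z => z - q) (by fun_prop)
    fun z hz h => hq (by rwa [← sub_eq_zero.mp h])
  have hsi : InjOn s U := fun z hz w hw h => by
    have h1 := (hs2 z hz).1
    rw [h, (hs2 w hw).1] at h1
    linear_combination -h1
  obtain ⟨ε, hε, hball⟩ := Metric.isOpen_iff.mp (isOpen_image_of_injOn hU hs hsi) (s a) ⟨a, ha, rfl⟩
  have hfar : ∀ z ∈ U, ε ≤ ‖s z + s a‖ := by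
    intro z hz
    by_contra! h
    have hmem : -s z ∈ ball (s a) ε := by
      rw [mem_ball, dist_eq_norm, ← norm_neg]
      rwa [neg_sub, sub_neg_eq_add, add_comm]
    obtain ⟨w, hw, hwz⟩ := hball hmem
    have h1 := (hs2 w hw).1
    rw [hwz, neg_sq, (hs2 z hz).1] at h1
    have h2 : z = w := by linear_combination h1
    subst h2
    exact (hs2 z hz).2 (by linear_combination (1 / 2 : ℂ) * hwz)
  have hpos : ∀ z ∈ U, s z + s a ≠ 0 := fun z hz h => by
    have := hfar z hz
    rw [h, norm_zero] at this
    linarith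
  set f₀ : ℂ → ℂ := fun z => (ε / 2 : ℂ) / (s z + s a) with hf₀
  have hf₀d : DifferentiableOn ℂ f₀ U := (differentiableOn_const _).div (hs.add_const _) hpos
  have hf₀m : MapsTo f₀ U (ball 0 1) := by
    intro z hz
    have h1 := hfar z hz
    rw [mem_ball_zero_iff, norm_div, div_lt_one (by linarith)]
    have : ‖(ε / 2 : ℂ)‖ = ε / 2 := by
      rw [norm_div, Complex.norm_real, Real.norm_of_nonneg hε.le]; simp
    linarith
  have hf₀i : InjOn f₀ U := by
    intro z hz w hw h
    have hε' : (ε : ℂ) / 2 ≠ 0 := by simp [hε.ne']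
    refine hsi hz hw ?_
    simp only [hf₀] at h
    rw [div_eq_div_iff (hpos z hz) (hpos w hw)] at h
    have := mul_left_cancel₀ hε' h
    linear_combination -this
  have hb := mem_ball_zero_iff.mp (hf₀m ha)
  exact ⟨fun z => moebiusMap (f₀ a) (f₀ z), (differentiableOn_moebiusMap hb).comp hf₀d hf₀m,
    (mapsTo_moebiusMap hb).comp hf₀m, (injOn_moebiusMap hb).comp hf₀i hf₀m, by simp⟩

/-- Koebe's square root trick. -/
theorem exists_norm_deriv_lt (hL : HasContinuousLogs U) (hU : IsOpen U) {a : ℂ} (ha : a ∈ U)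
    {f : ℂ → ℂ} (hf : IsDiscEmbedding U a f) {b : ℂ} (hb : ‖b‖ < 1) (hbU : b ∉ f '' U) :
    ∃ k, IsDiscEmbedding U a k ∧ ‖deriv f a‖ < ‖deriv k a‖ := by
  have hfb : ∀ z ∈ U, ‖f z‖ < 1 := fun z hz => mem_ball_zero_iff.mp (hf.mapsTo hz)
  have hhd : DifferentiableOn ℂ (fun z => moebiusMap b (f z)) U :=
    (differentiableOn_moebiusMap hb).comp hf.differentiableOn hf.mapsTo
  obtain ⟨s, hs, hs2⟩ := hL.exists_sqrt hU hhd fun z hz h => by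
    rcases div_eq_zero_iff.mp h with h | h
    · exact hbU ⟨z, hz, sub_eq_zero.mp h⟩
    · exact moebiusMap_denom_ne_zero hb (hfb z hz) h
  have hsb : ∀ z ∈ U, ‖s z‖ < 1 := fun z hz => by
    have h1 := norm_moebiusMap_lt_one hb (hfb z hz)
    rw [← (hs2 z hz).1, norm_pow] at h1
    nlinarith [norm_nonneg (s z)]
  have hsm : MapsTo s U (ball 0 1) := fun z hz => mem_ball_zero_iff.mpr (hsb z hz)
  have hsi : InjOn s U := by
    intro z hz w hw h
    refine hf.injOn hz hw (injOn_moebiusMap hb (hf.mapsTo hz) (hf.mapsTo hw) ?_)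
    rw [← (hs2 z hz).1, ← (hs2 w hw).1, h]
  have hsa := hsb a ha
  refine ⟨fun z => moebiusMap (s a) (s z), ⟨(differentiableOn_moebiusMap hsa).comp hs hsm,
    (mapsTo_moebiusMap hsa).comp hsm, (injOn_moebiusMap hsa).comp hsi hsm, by simp⟩, ?_⟩
  have hU' := hU.mem_nhds ha
  have dk := (hasDerivAt_moebiusMap hsa hsa).comp a (hs.differentiableAt hU').hasDerivAt
  have dk' : deriv (fun z => moebiusMap (s a) (s z)) a = _ := dk.deriv
  rw [dk']
  have d1 := (hs.differentiableAt hU').hasDerivAt.pow 2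
  have d2 := (hasDerivAt_moebiusMap hb (hfb a ha)).comp a
    (hf.differentiableOn.differentiableAt hU').hasDerivAt
  have heq := (d1.congr_of_eventuallyEq (f₁ := fun z => moebiusMap b (f z)) (by
    filter_upwards [hU'] with z hz using (hs2 z hz).1.symm)).unique d2
  rw [hf.map_zero] at heq
  simp only [mul_zero, sub_zero, one_pow, div_one, Nat.cast_ofNat, Nat.add_one_sub_one,
    pow_one] at heq
  have hba : ‖s a‖ ^ 2 = ‖b‖ := by
    rw [← norm_pow, (hs2 a ha).1, hf.map_zero, moebiusMap_zero_right, norm_neg]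
  have hconj : ∀ c : ℂ, ‖c‖ < 1 → ‖1 - (starRingEnd ℂ) c * c‖ = 1 - ‖c‖ ^ 2 := by
    intro c hc
    rw [← Complex.normSq_eq_conj_mul_self, ← Complex.ofReal_one, ← Complex.ofReal_sub,
      Complex.norm_real, Complex.normSq_eq_norm_sq, Real.norm_of_nonneg]
    nlinarith [norm_nonneg c]
  have heq' := congrArg norm heq
  rw [norm_mul, norm_mul, norm_mul, hconj b hb, ← hba] at heq'
  rw [norm_mul, norm_div, norm_pow, hconj _ hsa]
  have hβ : 0 < ‖s a‖ := norm_pos_iff.mpr (hs2 a ha).2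
  set β := ‖s a‖
  have hf' : 0 < ‖deriv f a‖ :=
    norm_pos_iff.mpr (deriv_ne_zero_of_injOn hU hf.differentiableOn hf.injOn ha)
  have h2 : ‖(2 : ℂ)‖ = 2 := by simp
  rw [h2] at heq'
  have hpos : 0 < 1 - β ^ 2 := by nlinarith
  rw [pow_two (1 - β ^ 2), div_mul_cancel_left₀ hpos.ne', inv_mul_eq_div, lt_div_iff₀ hpos]
  -- With `β ^ 2 = ‖b‖`, the derivative grows by the factor `(1 + β ^ 2) / (2 * β)`, which exceeds 1
  -- because `(1 - β) ^ 2 > 0`.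
  have h3 : 0 < (1 - β ^ 2) * (1 - β) ^ 2 * ‖deriv f a‖ := by
    have : 0 < 1 - β := by linarith
    positivity
  nlinarith

/-- The **Riemann mapping theorem**. -/
theorem exists_riemannMap (hL : HasContinuousLogs U) (hU : IsOpen U) (hUc : IsPreconnected U)
    (hne : U ≠ univ) {a : ℂ} (ha : a ∈ U) :
    ∃ f g : ℂ → ℂ, DifferentiableOn ℂ f U ∧ MapsTo f U (ball 0 1) ∧ f a = 0 ∧
      DifferentiableOn ℂ g (ball 0 1) ∧ MapsTo g (ball 0 1) U ∧ LeftInvOn g f U ∧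
      RightInvOn g f (ball 0 1) := by
  -- The Riemann map maximizes the derivative at `a`: Montel gives a limit, Hurwitz keeps it
  -- injective because its derivative is nonzero, and a missed value would contradict maximality by
  -- Koebe's trick.
  set A : Set ℝ := {r | ∃ f, IsDiscEmbedding U a f ∧ r = ‖deriv f a‖} with hA
  obtain ⟨f₀, hf₀⟩ := hL.exists_isDiscEmbedding hU hne ha
  obtain ⟨r, hr, hrU⟩ := Metric.isOpen_iff.mp hU a ha
  have hbdd : BddAbove A := by
    refine ⟨1 / r, ?_⟩
    rintro _ ⟨f, hf, rfl⟩
    refine Complex.norm_deriv_le_div_of_mapsTo_ball (hf.differentiableOn.mono hrU) ?_ hr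
    rw [hf.map_zero]
    exact (hf.mapsTo.mono_left hrU).mono_right ball_subset_closedBall
  have hAne : A.Nonempty := ⟨_, f₀, hf₀, rfl⟩
  obtain ⟨v, -, hv, hvA⟩ := exists_seq_tendsto_sSup hAne hbdd
  choose F hF hvF using hvA
  obtain ⟨φ, hφ, f, hfd, hlim⟩ := exists_subseq_tendstoLocallyUniformlyOn hU
    (fun j => (hF j).differentiableOn) (fun z hz => ⟨1, one_pos, 1, fun j w _ hw =>
      (mem_ball_zero_iff.mp ((hF j).mapsTo hw)).le⟩)
  have hderiv : ‖deriv f a‖ = sSup A := by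
    have h1 := ((hlim.deriv (.of_forall fun j => (hF _).differentiableOn) hU).tendsto_at ha).norm
    have h2 : Tendsto (fun j => v (φ j)) atTop (𝓝 (sSup A)) := hv.comp hφ.tendsto_atTop
    refine tendsto_nhds_unique h1 (h2.congr fun j => ?_)
    simp [hvF]
  have hpos : 0 < ‖deriv f a‖ := by
    rw [hderiv]
    exact (norm_pos_iff.mpr (deriv_ne_zero_of_injOn hU hf₀.differentiableOn hf₀.injOn ha)).trans_le
      (le_csSup hbdd ⟨f₀, hf₀, rfl⟩)
  have hinj : InjOn f U := by
    refine injOn_of_tendstoLocallyUniformlyOn hU hUc (fun j => (hF _).differentiableOn)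
      (fun j => (hF _).injOn) hlim fun c hc => ?_
    have : f =ᶠ[𝓝 a] fun _ => c := by filter_upwards [hU.mem_nhds ha] with z hz using hc z hz
    rw [this.deriv_eq, deriv_const, norm_zero] at hpos
    exact lt_irrefl _ hpos
  have hle : f '' U ⊆ closedBall 0 1 := by
    rintro _ ⟨z, hz, rfl⟩
    rw [mem_closedBall_zero_iff]
    exact le_of_tendsto (hlim.tendsto_at hz).norm
      (.of_forall fun j => (mem_ball_zero_iff.mp ((hF _).mapsTo hz)).le)
  have hmaps : MapsTo f U (ball 0 1) := by
    have := interior_maximal hle (isOpen_image_of_injOn hU hfd hinj)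
    rw [interior_closedBall _ one_ne_zero] at this
    exact fun z hz => this ⟨z, hz, rfl⟩
  have hfa : f a = 0 := by
    refine tendsto_nhds_unique (hlim.tendsto_at ha) ?_
    simp [(hF _).map_zero]
  have hfe : IsDiscEmbedding U a f := ⟨hfd, hmaps, hinj, hfa⟩
  have hsurj : f '' U = ball 0 1 := by
    refine subset_antisymm (image_subset_iff.mpr hmaps) fun b hb => ?_
    by_contra hbU
    obtain ⟨k, hk, hlt⟩ := hL.exists_norm_deriv_lt hU ha hfe (mem_ball_zero_iff.mp hb) hbU
    rw [hderiv] at hlt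
    exact absurd (le_csSup hbdd ⟨k, hk, rfl⟩) (not_le.mpr hlt)
  have hg := hinj.leftInvOn_invFunOn
  refine ⟨f, Function.invFunOn f U, hfd, hmaps, hfa, ?_, ?_, hg, ?_⟩
  · rw [← hsurj]; exact differentiableOn_of_leftInvOn hU hfd hg
  · rw [← hsurj]; rintro _ ⟨z, hz, rfl⟩; rw [hg hz]; exact hz
  · rw [← hsurj]; rintro _ ⟨z, hz, rfl⟩; rw [hg hz]

end HasContinuousLogs

/-! ### Support functionals, bounded models and the Carathéodory distance -/

/-- A functional whose image of `D` is hyperbolic and simply connected when `D` is `ℂ`-convex. -/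
structure IsSupportFunctional {n : ℕ} (D : Set (CSpace n)) (ℓ : CSpace n →L[ℂ] ℂ) : Prop where
  ne_zero : ℓ ≠ 0
  image_ne_univ : ℓ '' D ≠ univ

/-- Holomorphic maps of `D` to the unit disc that vanish at `a`. -/
structure IsDiscMap {n : ℕ} (D : Set (CSpace n)) (a : CSpace n) (f : CSpace n → ℂ) : Prop where
  differentiableOn : DifferentiableOn ℂ f D
  mapsTo : MapsTo f D (ball 0 1)
  map_zero : f a = 0

theorem IsDiscMap.norm_lt_one {n : ℕ} {D : Set (CSpace n)} {a z : CSpace n} {f : CSpace n → ℂ}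
    (hf : IsDiscMap D a f) (hz : z ∈ D) : ‖f z‖ < 1 :=
  mem_ball_zero_iff.mp (hf.mapsTo hz)

theorem RelCompactIn.mono {n : ℕ} {S T D : Set (CSpace n)} (h : RelCompactIn T D) (hST : S ⊆ T) :
    RelCompactIn S D :=
  ⟨h.1.of_isClosed_subset isClosed_closure (closure_mono hST), (closure_mono hST).trans h.2⟩

namespace IsCConvexDomain

variable {n : ℕ} {D : Set (CSpace n)}

theorem exists_isSupportFunctional (hD : IsCConvexDomain D) {p : CSpace n} (hp : p ∉ D) :
    ∃ ℓ, IsSupportFunctional D ℓ ∧ ℓ p ∉ ℓ '' D := by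
  obtain ⟨ℓ, hℓ⟩ := hD.exists_functional_notMem_image hp
  refine ⟨ℓ, ⟨?_, fun h => hℓ (by rw [h]; trivial)⟩, hℓ⟩
  rintro rfl
  obtain ⟨a, ha⟩ := hD.isCDomain.isConnected.nonempty
  exact hℓ ⟨a, ha, by simp⟩

/-- If `b ≠ 0`, the line through a point of `D` in direction `b` leaves `D` somewhere, and the
functional separating an exit point would be constant along the line. -/
theorem eq_zero_of_support (hD : IsCConvexDomain D) (hline : ¬ ContainsComplexLine D)
    {b : CSpace n} (hb : ∀ ℓ, IsSupportFunctional D ℓ → ℓ b = 0) : b = 0 := by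
  by_contra hb0
  obtain ⟨a, ha⟩ := hD.isCDomain.isConnected.nonempty
  refine hline ⟨a, b, hb0, ?_⟩
  rintro _ ⟨t, rfl⟩
  by_contra h
  obtain ⟨ℓ, hℓ, hp⟩ := hD.exists_isSupportFunctional h
  exact hp ⟨a, ha, by simp [hb ℓ hℓ]⟩

/-- A proper span of the support functionals would be annihilated by a nonzero element of the
bidual, that is, by a vector excluded by `eq_zero_of_support`. -/
theorem exists_coordinates (hD : IsCConvexDomain D) (hline : ¬ ContainsComplexLine D) :
    ∃ (ℓ : Fin n → CSpace n →L[ℂ] ℂ) (L : CSpace n ≃L[ℂ] CSpace n),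
      (∀ i, IsSupportFunctional D (ℓ i)) ∧ ∀ z i, L z i = ℓ i z := by
  set S : Set (Module.Dual ℂ (CSpace n)) :=
    {f | IsSupportFunctional D (LinearMap.toContinuousLinearMap f)} with hS
  have hspan : (⊤ : Submodule ℂ (Module.Dual ℂ (CSpace n))) ≤ Submodule.span ℂ S := by
    by_contra h
    obtain ⟨F, hF, hker⟩ := Submodule.exists_le_ker_of_lt_top (Submodule.span ℂ S)
      (lt_top_iff_ne_top.mpr fun h' => h h'.ge)
    set b := (Module.evalEquiv ℂ (CSpace n)).symm F with hb
    have hFb : ∀ f : Module.Dual ℂ (CSpace n), F f = f b := fun f => by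
      rw [← Module.Dual.eval_apply ℂ (CSpace n) b f, ← Module.evalEquiv_toLinearMap, hb]
      simp
    have hb0 := hD.eq_zero_of_support hline (b := b) fun ℓ hℓ => by
      have h1 : (ℓ : Module.Dual ℂ (CSpace n)) ∈ S := hℓ
      have h2 : F (ℓ : Module.Dual ℂ (CSpace n)) = 0 := hker (Submodule.subset_span h1)
      rwa [hFb] at h2
    exact hF (LinearMap.ext fun f => by rw [hFb, hb0, map_zero, LinearMap.zero_apply])
  obtain ⟨ι, B, hBS⟩ : ∃ (ι : Type) (B : Module.Basis ι ℂ (Module.Dual ℂ (CSpace n))),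
      ∀ i, B i ∈ S :=
    ⟨_, Module.Basis.ofSpan hspan, fun i => Module.Basis.ofSpan_subset hspan ⟨i, rfl⟩⟩
  have : Finite ι := Module.Finite.finite_basis B
  have : Fintype ι := Fintype.ofFinite ι
  have hcard := Module.finrank_eq_card_basis B
  rw [Subspace.dual_finrank_eq, finrank_euclideanSpace_fin] at hcard
  let B' := B.reindex (Fintype.equivFinOfCardEq hcard.symm)
  have hB'S : ∀ i, B' i ∈ S := fun i => by
    simp only [B', Module.Basis.reindex_apply]; exact hBS _
  let T : CSpace n →ₗ[ℂ] CSpace n :=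
    (WithLp.linearEquiv 2 ℂ (Fin n → ℂ)).symm.toLinearMap ∘ₗ LinearMap.pi fun i => B' i
  have hT : ∀ z i, T z i = B' i z := fun z i => rfl
  have hTi : Function.Injective T := by
    rw [← LinearMap.ker_eq_bot, LinearMap.ker_eq_bot']
    intro z hz
    have h1 : ∀ i, B' i z = 0 := fun i => by rw [← hT, hz]; rfl
    have h2 : Module.Dual.eval ℂ (CSpace n) z = 0 := B'.ext fun i => by simpa using h1 i
    exact (Module.forall_dual_apply_eq_zero_iff ℂ z).mp fun f => congr($h2 f)
  exact ⟨fun i => LinearMap.toContinuousLinearMap (B' i),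
    (LinearEquiv.ofInjectiveEndo T hTi).toContinuousLinearEquiv, hB'S, fun z i => hT z i⟩

theorem exists_riemannMap (hD : IsCConvexDomain D) {ℓ : CSpace n →L[ℂ] ℂ}
    (hℓ : IsSupportFunctional D ℓ) {a : CSpace n} (ha : a ∈ D) :
    ∃ f g : ℂ → ℂ, IsDiscMap D a (fun z => f (ℓ z)) ∧
      DifferentiableOn ℂ g (ball 0 1) ∧ MapsTo g (ball 0 1) (ℓ '' D) ∧
      (∀ z ∈ D, g (f (ℓ z)) = ℓ z) ∧ RightInvOn g f (ball 0 1) := by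
  obtain ⟨f, g, h1, h2, h3, h4, h5, h6, h7⟩ := (hD.hasContinuousLogs_image hℓ.ne_zero).exists_riemannMap
    (hD.isOpen_image hℓ.ne_zero)
    (hD.isCDomain.isConnected.isPreconnected.image ℓ ℓ.continuous.continuousOn)
    hℓ.image_ne_univ (mem_image_of_mem ℓ ha)
  exact ⟨f, g, ⟨h1.comp ℓ.differentiable.differentiableOn (mapsTo_image _ _),
    h2.comp (mapsTo_image _ _), h3⟩, h4, h5, fun z hz => h6 (mem_image_of_mem ℓ hz), h7⟩

theorem exists_biholomorphic_bounded (hD : IsCConvexDomain D) (hline : ¬ ContainsComplexLine D) :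
    ∃ G : Set (CSpace n), IsCDomain G ∧ Bornology.IsBounded G ∧ AreBiholomorphic D G := by
  obtain ⟨a, ha⟩ := hD.isCDomain.isConnected.nonempty
  obtain ⟨ℓ, L, hℓ, hL⟩ := hD.exists_coordinates hline
  choose f g hf hg hgm hgf hfg using fun i => hD.exists_riemannMap (hℓ i) ha
  set Φ : CSpace n → CSpace n := fun z => WithLp.toLp 2 fun i => f i (ℓ i z) with hΦ
  set Ψ : CSpace n → CSpace n := fun w => L.symm (WithLp.toLp 2 fun i => g i (w i)) with hΨ
  set P : Set (CSpace n) := {w | ∀ i, w i ∈ ball (0 : ℂ) 1} with hP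
  have hcoord : ∀ i, Continuous fun w : CSpace n => w i := fun i => by fun_prop
  have hPo : IsOpen P := by
    simp only [hP, ofPred_forall]
    exact isOpen_iInter_of_finite fun i => isOpen_ball.preimage (hcoord i)
  have hΦd : DifferentiableOn ℂ Φ D := differentiableOn_euclidean.mpr fun i => (hf i).differentiableOn
  have hΦP : MapsTo Φ D P := fun z hz i => (hf i).mapsTo hz
  have hΨd : DifferentiableOn ℂ Ψ P := by
    refine L.symm.differentiable.comp_differentiableOn (differentiableOn_euclidean.mpr fun i => ?_)
    refine (hg i).comp (t := ball 0 1) (f := fun w : CSpace n => w i) ?_ fun w hw => hw i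
    exact Differentiable.differentiableOn (by fun_prop)
  have hΨΦ : LeftInvOn Ψ Φ D := by
    intro z hz
    simp only [hΨ, hΦ]
    rw [ContinuousLinearEquiv.symm_apply_eq]
    ext i
    rw [hL]
    exact hgf i z hz
  have hΦΨ : ∀ w ∈ P, Φ (Ψ w) = w := by
    intro w hw
    ext i
    have h1 : ℓ i (Ψ w) = g i (w i) := by rw [← hL]; simp [hΨ]
    change f i (ℓ i (Ψ w)) = w i
    rw [h1]; exact hfg i (hw i)
  -- The inverse `Ψ` is defined on the whole polydisc, which exhibits the image as an open set.
  have hG : Φ '' D = P ∩ Ψ ⁻¹' D := by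
    ext w
    constructor
    · rintro ⟨z, hz, rfl⟩
      exact ⟨hΦP hz, by rw [mem_preimage, hΨΦ hz]; exact hz⟩
    · rintro ⟨hw, hw'⟩
      exact ⟨Ψ w, hw', hΦΨ w hw⟩
  refine ⟨Φ '' D, ⟨?_, hD.isCDomain.isConnected.image Φ hΦd.continuousOn⟩, ?_,
    Φ, Ψ, hΦd, hΨd.mono (by rw [hG]; exact inter_subset_left), mapsTo_image _ _,
    by rw [hG]; exact fun w hw => hw.2, hΨΦ, fun w hw => hΦΨ w (hG ▸ hw).1⟩
  · rw [hG]; exact hΨd.continuousOn.isOpen_inter_preimage hPo hD.isCDomain.isOpen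
  · refine isBounded_iff_forall_norm_le.mpr ⟨Real.sqrt (∑ _ : Fin n, 1), ?_⟩
    rintro _ ⟨z, hz, rfl⟩
    rw [EuclideanSpace.norm_eq]
    refine Real.sqrt_le_sqrt (Finset.sum_le_sum fun i _ => ?_)
    exact pow_le_one₀ (norm_nonneg _) ((hf i).norm_lt_one hz).le

/-- The sublevel sets of the functions `‖f‖`, `f` ranging over the holomorphic maps to the unit
disc that vanish at `a`, are relatively compact. -/
theorem relCompactIn_discMap_le (hD : IsCConvexDomain D) (hline : ¬ ContainsComplexLine D)
    {a : CSpace n} (ha : a ∈ D) {ρ : ℝ} (hρ : ρ < 1) :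
    RelCompactIn {z | z ∈ D ∧ ∀ f, IsDiscMap D a f → ‖f z‖ ≤ ρ} D := by
  set S := {z | z ∈ D ∧ ∀ f, IsDiscMap D a f → ‖f z‖ ≤ ρ} with hS
  have hK : ∀ ℓ, IsSupportFunctional D ℓ → ∃ K, IsCompact K ∧ K ⊆ ℓ '' D ∧ ∀ z ∈ S, ℓ z ∈ K := by
    intro ℓ hℓ
    obtain ⟨f, g, h1, h2, h3, h4, -⟩ := hD.exists_riemannMap hℓ ha
    have hsub : closedBall (0 : ℂ) ρ ⊆ ball 0 1 := closedBall_subset_ball hρ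
    refine ⟨g '' closedBall 0 ρ, (isCompact_closedBall _ _).image_of_continuousOn
      (h2.continuousOn.mono hsub), (h3.mono_left hsub).image_subset, fun z hz => ?_⟩
    exact ⟨_, mem_closedBall_zero_iff.mpr (hz.2 _ h1), h4 z hz.1⟩
  obtain ⟨ℓ, L, hℓ, hL⟩ := hD.exists_coordinates hline
  choose K hKc hKD hKS using fun i => hK (ℓ i) (hℓ i)
  have hC : IsCompact (L.symm '' (WithLp.toLp 2 '' univ.pi K) : Set (CSpace n)) :=
    ((isCompact_univ_pi hKc).image (PiLp.continuous_toLp 2 _)).image L.symm.continuous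
  have hSC : S ⊆ L.symm '' (WithLp.toLp 2 '' univ.pi K) := fun z hz =>
    ⟨L z, ⟨fun i => L z i, fun i _ => by simp only [hL]; exact hKS i z hz, rfl⟩, by simp⟩
  refine ⟨hC.of_isClosed_subset isClosed_closure (closure_minimal hSC hC.isClosed),
    fun q hq => ?_⟩
  -- The coordinates only bound the set; each limit point outside `D` is excluded by its own support
  -- functional, whose values on the closure stay in a compact part of `ℓ '' D`.
  by_contra hqD
  obtain ⟨ℓ, hℓ, hp⟩ := hD.exists_isSupportFunctional hqD
  obtain ⟨K, hKc, hKD, hKS⟩ := hK ℓ hℓ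
  refine hp (hKD ?_)
  exact closure_minimal (t := ℓ ⁻¹' K) hKS (hKc.isClosed.preimage ℓ.continuous) hq

theorem moebiusDist_lt_tanh {z w : CSpace n} {r : ℝ} (hr : 0 < r)
    (h : caratheodoryDist D z w < ENNReal.ofReal r) {f : CSpace n → ℂ}
    (hf : DifferentiableOn ℂ f D) (hm : MapsTo f D (ball 0 1)) (hz : z ∈ D) (hw : w ∈ D) :
    moebiusDist (f z) (f w) < Real.tanh r := by
  have h1 : ENNReal.ofReal (poincareDist (f z) (f w)) < ENNReal.ofReal r :=
    (le_iSup₂ (f := fun (f : CSpace n → ℂ)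
      (_ : DifferentiableOn ℂ f D ∧ MapsTo f D (ball (0 : ℂ) 1)) =>
        ENNReal.ofReal (poincareDist (f z) (f w))) f ⟨hf, hm⟩).trans_lt h
  rw [ENNReal.ofReal_lt_ofReal_iff hr, poincareDist] at h1
  have h0 : 0 ≤ moebiusDist (f z) (f w) := norm_nonneg _
  have hlt : moebiusDist (f z) (f w) < 1 := norm_moebiusMap_lt_one
    (mem_ball_zero_iff.mp (hm hw)) (mem_ball_zero_iff.mp (hm hz))
  rwa [← Real.artanh_tanh r, Real.artanh_lt_artanh_iff ⟨by linarith, hlt⟩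
    ⟨Real.neg_one_lt_tanh r, Real.tanh_lt_one r⟩] at h1

theorem caratheodoryBall_subset {a : CSpace n} (ha : a ∈ D) {r : ℝ} (hr : 0 < r) :
    {z | z ∈ D ∧ caratheodoryDist D a z < ENNReal.ofReal r} ⊆
      {z | z ∈ D ∧ ∀ f, IsDiscMap D a f → ‖f z‖ ≤ Real.tanh r} := by
  rintro z ⟨hz, h⟩
  refine ⟨hz, fun f hf => ?_⟩
  have := moebiusDist_lt_tanh hr h hf.differentiableOn hf.mapsTo ha hz
  rw [hf.map_zero] at this
  simpa [moebiusDist] using this.le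

theorem isCFinitelyCompact (hD : IsCConvexDomain D) (hline : ¬ ContainsComplexLine D) :
    IsCFinitelyCompact D := fun _ ha _ hr =>
  (hD.relCompactIn_discMap_le hline ha (Real.tanh_lt_one _)).mono (caratheodoryBall_subset ha hr)

theorem eq_of_forall_eq (hD : IsCConvexDomain D) (hline : ¬ ContainsComplexLine D)
    {z w : CSpace n} (hz : z ∈ D) (hw : w ∈ D)
    (h : ∀ f : CSpace n → ℂ, DifferentiableOn ℂ f D → MapsTo f D (ball 0 1) → f z = f w) :
    z = w := by
  refine sub_eq_zero.mp (hD.eq_zero_of_support hline fun ℓ hℓ => ?_)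
  obtain ⟨f, g, h1, -, -, h4, -⟩ := hD.exists_riemannMap hℓ hz
  have := h _ h1.differentiableOn h1.mapsTo
  rw [map_sub, ← h4 z hz, ← h4 w hw, this, sub_self]

/-- A Cauchy sequence eventually lies in a compact subset of `D` by finite compactness, and every
holomorphic map to the disc converges along it. Such maps separate points, so there is only one
cluster point. -/
theorem isCComplete (hD : IsCConvexDomain D) (hline : ¬ ContainsComplexLine D) :
    IsCComplete D := by
  have hdist : ∀ f : CSpace n → ℂ, DifferentiableOn ℂ f D → MapsTo f D (ball 0 1) →
      ∀ z ∈ D, ∀ w ∈ D, ∀ δ : ℝ, 0 < δ → δ < 1 →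
        caratheodoryDist D z w < ENNReal.ofReal (Real.artanh δ) → dist (f z) (f w) < 2 * δ := by
    intro f hf hm z hz w hw δ hδ hδ1 h
    have h1 := moebiusDist_lt_tanh (Real.artanh_pos ⟨hδ, hδ1⟩) h hf hm hz hw
    rw [Real.tanh_artanh ⟨by linarith, hδ1⟩] at h1
    have hfz := mem_ball_zero_iff.mp (hm hz)
    have hfw := mem_ball_zero_iff.mp (hm hw)
    have hd := moebiusMap_denom_ne_zero hfw hfz
    have h2 : f z - f w = (f z - f w) / (1 - (starRingEnd ℂ) (f w) * f z) *
        (1 - (starRingEnd ℂ) (f w) * f z) := (div_mul_cancel₀ _ hd).symm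
    -- The Möbius denominator is the source of the factor 2 in passing to Euclidean distance.
    have h3 : ‖1 - (starRingEnd ℂ) (f w) * f z‖ ≤ 2 := by
      refine (norm_sub_le _ _).trans ?_
      rw [norm_one, norm_mul, RCLike.norm_conj]
      nlinarith [norm_nonneg (f z), norm_nonneg (f w)]
    rw [dist_eq_norm, h2, norm_mul]
    have h4 : 0 < ‖1 - (starRingEnd ℂ) (f w) * f z‖ := norm_pos_iff.mpr hd
    calc _ < δ * ‖1 - (starRingEnd ℂ) (f w) * f z‖ := by
          exact mul_lt_mul_of_pos_right h1 h4
      _ ≤ 2 * δ := by nlinarith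
  refine ⟨fun z hz w hw h => hD.eq_of_forall_eq hline hz hw fun f hf hm => ?_, fun x hx hc => ?_⟩
  · refine dist_le_zero.mp (le_of_forall_pos_lt_add fun ε hε => ?_)
    have hδ : 0 < min (ε / 2) (1 / 2) := by positivity
    have hδ1 : min (ε / 2) (1 / 2) < (1 : ℝ) := (min_le_right _ _).trans_lt (by norm_num)
    have := hdist f hf hm z hz w hw _ hδ hδ1 (by
      rw [h]; exact ENNReal.ofReal_pos.mpr (Real.artanh_pos ⟨hδ, hδ1⟩))
    linarith [min_le_left (ε / 2) (1 / 2)]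
  · have hcauchy : ∀ f : CSpace n → ℂ, DifferentiableOn ℂ f D → MapsTo f D (ball 0 1) →
        ∃ c, Tendsto (fun j => f (x j)) atTop (𝓝 c) := by
      intro f hf hm
      refine cauchySeq_tendsto_of_complete (Metric.cauchySeq_iff.mpr fun ε hε => ?_)
      have hδ : 0 < min (ε / 2) (1 / 2) := by positivity
      have hδ1 : min (ε / 2) (1 / 2) < (1 : ℝ) := (min_le_right _ _).trans_lt (by norm_num)
      obtain ⟨N, hN⟩ := hc _ (Real.artanh_pos ⟨hδ, hδ1⟩)
      refine ⟨N, fun j hj k hk => ?_⟩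
      have := hdist f hf hm _ (hx j) _ (hx k) _ hδ hδ1 (hN j hj k hk)
      linarith [min_le_left (ε / 2) (1 / 2)]
    obtain ⟨N, hN⟩ := hc 1 one_pos
    obtain ⟨hKc, hKD⟩ := hD.isCFinitelyCompact hline (x N) (hx N) 1 one_pos
    have hmem : ∀ᶠ j in atTop, x j ∈ closure
        {z | z ∈ D ∧ caratheodoryDist D (x N) z < ENNReal.ofReal 1} := by
      filter_upwards [eventually_ge_atTop N] with j hj
      exact subset_closure ⟨hx j, hN N le_rfl j hj⟩
    have hval : ∀ y ∈ D, MapClusterPt y atTop x → ∀ f : CSpace n → ℂ, DifferentiableOn ℂ f D →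
        MapsTo f D (ball 0 1) → Tendsto (fun j => f (x j)) atTop (𝓝 (f y)) := by
      intro y hy hyc f hf hm
      obtain ⟨c, hc⟩ := hcauchy f hf hm
      have h1 : MapClusterPt (f y) atTop (f ∘ x) :=
        hyc.tendsto_comp (hf.continuousOn.continuousAt (hD.isCDomain.isOpen.mem_nhds hy))
      have h2 : f y = c := by
        by_contra hne
        have h3 : 𝓝 (f y) ⊓ 𝓝 c = ⊥ := disjoint_iff.mp (disjoint_nhds_nhds.mpr hne)
        have h4 : ClusterPt (f y) (map (f ∘ x) atTop) := h1
        have h5 : (𝓝 (f y) ⊓ 𝓝 c).NeBot := NeBot.mono h4 (inf_le_inf_left _ hc)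
        exact h5.ne h3
      rwa [h2]
    obtain ⟨y, hyK, hy⟩ := hKc.exists_mapClusterPt (u := x) (f := atTop)
      (by rwa [le_principal_iff, mem_map])
    refine ⟨y, hKD hyK, hKc.tendsto_nhds_of_unique_mapClusterPt hmem fun y' hy'K hy' => ?_⟩
    exact hD.eq_of_forall_eq hline (hKD hy'K) (hKD hyK) fun f hf hm =>
      tendsto_nhds_unique (hval y' (hKD hy'K) hy' f hf hm) (hval y (hKD hyK) hy f hf hm)

end IsCConvexDomain

/-! ### The extremal function, hyperconvexity and tautness -/

theorem norm_circleAverage_le {E : Type*} [NormedAddCommGroup E] [NormedSpace ℝ E] (f : ℂ → E)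
    (c : ℂ) (R : ℝ) :
    ‖Real.circleAverage f c R‖ ≤ Real.circleAverage (fun z => ‖f z‖) c R := by
  rw [Real.circleAverage, Real.circleAverage, norm_smul, smul_eq_mul,
    Real.norm_of_nonneg (inv_nonneg.mpr Real.two_pi_pos.le)]
  gcongr
  exact intervalIntegral.norm_integral_le_integral_norm Real.two_pi_pos.le

theorem exists_moebiusMap_le {r : ℝ} (hr : r < 1) :
    ∃ m, 0 ≤ m ∧ m < 1 ∧ ∀ z w : ℂ, ‖z‖ ≤ r → ‖w‖ ≤ r → ‖moebiusMap w z‖ ≤ m := by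
  rcases lt_or_ge r 0 with h0 | h0
  · exact ⟨0, le_rfl, one_pos, fun z w hz => absurd (hz.trans_lt h0) (norm_nonneg z).not_gt⟩
  have hr2 : 0 < 1 - r ^ 2 := by nlinarith
  refine ⟨√(1 - (1 - r ^ 2) ^ 2 / 4), Real.sqrt_nonneg _, ?_, fun z w hz hw =>
    Real.le_sqrt_of_sq_le ?_⟩
  · rw [Real.sqrt_lt' one_pos]
    have := pow_pos hr2 2
    linarith
  · have hz1 := hz.trans_lt hr
    have hw1 := hw.trans_lt hr
    have hz2 : ‖z‖ ^ 2 ≤ r ^ 2 := by gcongr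
    have hw2 : ‖w‖ ^ 2 ≤ r ^ 2 := by gcongr
    have h1 := one_sub_sq_norm_moebiusMap hw1 hz1
    have h2 : (1 - r ^ 2) ^ 2 ≤ (1 - ‖z‖ ^ 2) * (1 - ‖w‖ ^ 2) := by
      rw [sq]; exact mul_le_mul (by linarith) (by linarith) hr2.le (by linarith)
    have h3 : ‖1 - (starRingEnd ℂ) w * z‖ ^ 2 ≤ 2 ^ 2 := by
      gcongr
      refine (norm_sub_le _ _).trans ?_
      rw [norm_one, norm_mul, RCLike.norm_conj]
      nlinarith [norm_nonneg z, norm_nonneg w]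
    have h4 : 0 ≤ 1 - ‖moebiusMap w z‖ ^ 2 := by
      nlinarith [norm_moebiusMap_lt_one hw1 hz1, norm_nonneg (moebiusMap w z)]
    nlinarith [mul_le_mul_of_nonneg_left h3 h4]

/-- The Möbius distance of the Carathéodory distance: the supremum of `‖f z‖` over the holomorphic
maps `f` to the unit disc that vanish at `a`. -/
noncomputable def discMapSup {n : ℕ} (D : Set (CSpace n)) (a z : CSpace n) : ℝ :=
  ⨆ f : {f // IsDiscMap D a f}, ‖f.1 z‖

section DiscMapSup

variable {n : ℕ} {D : Set (CSpace n)} {a : CSpace n}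

theorem isDiscMap_zero : IsDiscMap D a 0 :=
  ⟨differentiableOn_const 0, fun _ _ => by simp, rfl⟩

instance : Nonempty {f // IsDiscMap D a f} := ⟨⟨0, isDiscMap_zero⟩⟩

theorem norm_le_discMapSup {z : CSpace n} (hz : z ∈ D) {f : CSpace n → ℂ} (hf : IsDiscMap D a f) :
    ‖f z‖ ≤ discMapSup D a z :=
  le_ciSup (f := fun f : {f // IsDiscMap D a f} => ‖f.1 z‖)
    ⟨1, by rintro _ ⟨f, rfl⟩; exact (f.2.norm_lt_one hz).le⟩ ⟨f, hf⟩

theorem discMapSup_le {z : CSpace n} {ρ : ℝ} (h : ∀ f, IsDiscMap D a f → ‖f z‖ ≤ ρ) :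
    discMapSup D a z ≤ ρ :=
  ciSup_le fun f => h f.1 f.2

theorem discMapSup_self : discMapSup D a a = 0 :=
  le_antisymm (discMapSup_le fun f hf => by simp [hf.map_zero])
    (Real.iSup_nonneg fun _ => norm_nonneg _)

/-- On a ball of radius `R` inside `D`, the Schwarz lemma gives all disc maps the same Lipschitz
constant `2 / R` at the centre, and the supremum inherits it. -/
theorem continuousOn_discMapSup (hD : IsOpen D) : ContinuousOn (discMapSup D a) D := by
  intro z₀ hz₀
  refine ContinuousAt.continuousWithinAt ?_
  obtain ⟨R, hR, hRD⟩ := Metric.isOpen_iff.mp hD z₀ hz₀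
  have hdist : ∀ z ∈ ball z₀ R, ∀ f, IsDiscMap D a f → dist (f z) (f z₀) ≤ 2 / R * dist z z₀ := by
    intro z hz f hf
    refine Complex.dist_le_div_mul_dist_of_mapsTo_ball (hf.differentiableOn.mono hRD)
      (fun w hw => ?_) hz
    rw [mem_closedBall, dist_eq_norm]
    linarith [norm_sub_le (f w) (f z₀), hf.norm_lt_one (hRD hw), hf.norm_lt_one hz₀]
  have hlim : Tendsto (fun z => 2 / R * dist z z₀) (𝓝 z₀) (𝓝 0) := by
    have : Continuous fun z => 2 / R * dist z z₀ := by fun_prop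
    simpa using this.tendsto z₀
  refine tendsto_iff_dist_tendsto_zero.mpr (squeeze_zero' (.of_forall fun _ => dist_nonneg) ?_ hlim)
  filter_upwards [ball_mem_nhds z₀ hR] with z hz
  rw [Real.dist_eq, abs_le]
  constructor
  · have : discMapSup D a z₀ ≤ discMapSup D a z + 2 / R * dist z z₀ :=
      discMapSup_le fun f hf => by
        have h1 := hdist z hz f hf
        rw [dist_eq_norm] at h1
        linarith [norm_le_discMapSup (hRD hz) hf, norm_sub_norm_le (f z₀) (f z),
          norm_sub_rev (f z₀) (f z)]
    linarith
  · have : discMapSup D a z ≤ discMapSup D a z₀ + 2 / R * dist z z₀ :=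
      discMapSup_le fun f hf => by
        have h1 := hdist z hz f hf
        rw [dist_eq_norm] at h1
        linarith [norm_le_discMapSup hz₀ hf, norm_sub_norm_le (f z) (f z₀)]
    linarith

/-- Control of `discMapSup` along a holomorphic disc. -/
theorem discMapSup_le_of_disc {φ : ℂ → CSpace n} (hφ : DifferentiableOn ℂ φ (ball 0 1))
    (hm : MapsTo φ (ball 0 1) D) {ζ ω : ℂ} (hζ : ‖ζ‖ < 1) (hω : ‖ω‖ < 1) {m ρ : ℝ} (hm1 : m < 1)
    (hmob : ‖moebiusMap ω ζ‖ ≤ m) (hρ1 : ρ < 1) (hρ : discMapSup D a (φ ω) ≤ ρ) :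
    discMapSup D a (φ ζ) ≤ √(1 - (1 - m ^ 2) * (1 - ρ) ^ 2) := by
  have hωD := hm (mem_ball_zero_iff.mpr hω)
  have hζD := hm (mem_ball_zero_iff.mpr hζ)
  refine discMapSup_le fun f hf => Real.le_sqrt_of_sq_le ?_
  refine sq_norm_le_of_moebiusMap_le ((norm_le_discMapSup hωD hf).trans hρ) hρ1
    (hf.norm_lt_one hζD) ?_ hm1
  exact (norm_moebiusMap_le_of_mapsTo (f := fun w => f (φ w)) (hf.differentiableOn.comp hφ hm)
    (hf.mapsTo.comp hm) hζ hω).trans hmob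

theorem sqrt_one_sub_lt_one {m ρ : ℝ} (hm0 : 0 ≤ m) (hm : m < 1) (hρ : ρ < 1) :
    √(1 - (1 - m ^ 2) * (1 - ρ) ^ 2) < 1 := by
  rw [Real.sqrt_lt' one_pos]
  have : 0 < (1 - m ^ 2) * (1 - ρ) ^ 2 :=
    mul_pos (by nlinarith) (pow_pos (by linarith) 2)
  linarith

/-- The supremum need not be known to be attained: the set where it is below 1 is open by continuity
and closed in `D` by Schwarz–Pick, so connectedness spreads it from `a`. -/
theorem discMapSup_lt_one (hD : IsCDomain D) (ha : a ∈ D) {z : CSpace n} (hz : z ∈ D) :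
    discMapSup D a z < 1 := by
  set A := D ∩ discMapSup D a ⁻¹' Iio 1 with hA
  have hAo : IsOpen A := (continuousOn_discMapSup hD.isOpen).isOpen_inter_preimage hD.isOpen isOpen_Iio
  have hsub : D ⊆ A := by
    refine hD.isConnected.isPreconnected.subset_of_closure_inter_subset hAo
      ⟨a, ha, ha, by simp [discMapSup_self]⟩ ?_
    rintro p ⟨hp, hpD⟩
    obtain ⟨R, hR, hRD⟩ := Metric.isOpen_iff.mp hD.isOpen p hpD
    obtain ⟨q, hqA, hqp⟩ := Metric.mem_closure_iff.mp hp (R / 2) (half_pos hR)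
    refine ⟨hpD, ?_⟩
    -- This disc has `p` at 0 and `q` at 1/2; it stays in the ball about `p` because `q` is within
    -- `R / 2`.
    set φ : ℂ → CSpace n := fun ζ => p + ζ • ((2 : ℂ) • (q - p)) with hφ
    have hφm : MapsTo φ (ball 0 1) D := by
      intro ζ hζ
      refine hRD ?_
      rw [mem_ball_zero_iff] at hζ
      rw [dist_eq_norm, norm_sub_rev] at hqp
      rw [mem_ball, dist_eq_norm, hφ, add_sub_cancel_left, norm_smul, norm_smul]
      have h2 : ‖(2 : ℂ)‖ = 2 := by simp
      rw [h2]
      nlinarith [norm_nonneg ζ, norm_nonneg (q - p)]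
    have h2 : ‖(1 / 2 : ℂ)‖ = 1 / 2 := by simp
    have hφ0 : φ 0 = p := by simp [hφ]
    have hφ1 : φ (1 / 2) = q := by simp [hφ]
    have hlt : discMapSup D a q < 1 := hqA.2
    have := discMapSup_le_of_disc (a := a) (φ := φ)
      (Differentiable.differentiableOn (by simp only [hφ]; fun_prop)) hφm (ζ := 0) (ω := 1 / 2)
      (by simp) (by rw [h2]; norm_num) (m := 1 / 2) (by norm_num)
      (by rw [moebiusMap_zero_right, norm_neg, h2]) hlt (by rw [hφ1])
    rw [hφ0] at this
    exact this.trans_lt (sqrt_one_sub_lt_one (by norm_num) (by norm_num) hlt)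
  exact (hsub hz).2

/-- Each `‖f‖` satisfies the mean value inequality, and a supremum keeps it; continuity makes the
circle average meaningful. -/
theorem contPlurisubharmonicOn_discMapSup (hD : IsOpen D) :
    ContPlurisubharmonicOn (fun z => discMapSup D a z - 1) D := by
  have hc := continuousOn_discMapSup (a := a) hD
  refine ⟨hc.sub continuousOn_const, fun p b hpb => ?_⟩
  set γ : ℂ → CSpace n := fun t => p + t • b with hγ
  have hγc : Continuous γ := by simp only [hγ]; fun_prop
  have hsph : MapsTo γ (sphere 0 1) D := fun t ht => hpb t (sphere_subset_closedBall ht)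
  have hint : CircleIntegrable (fun t => discMapSup D a (γ t)) 0 1 :=
    ContinuousOn.circleIntegrable zero_le_one (hc.comp hγc.continuousOn hsph)
  have h1 : discMapSup D a p ≤ Real.circleAverage (fun t => discMapSup D a (γ t)) 0 1 := by
    refine discMapSup_le fun f hf => ?_
    have hfγ : DifferentiableOn ℂ (fun t => f (γ t)) (closedBall 0 1) :=
      hf.differentiableOn.comp (Differentiable.differentiableOn (by simp only [hγ]; fun_prop)) hpb
    have hmean : Real.circleAverage (fun t => f (γ t)) 0 1 = f p := by
      have : DiffContOnCl ℂ (fun t => f (γ t)) (ball 0 |1|) := by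
        rw [abs_one]
        exact DifferentiableOn.diffContOnCl (by rwa [closure_ball _ one_ne_zero])
      rw [this.circleAverage]; simp [hγ]
    rw [← hmean]
    refine (norm_circleAverage_le _ _ _).trans (Real.circleAverage_mono ?_ hint fun t ht => ?_)
    · exact ContinuousOn.circleIntegrable zero_le_one
        (hfγ.continuousOn.mono sphere_subset_closedBall).norm
    · rw [abs_one] at ht
      exact norm_le_discMapSup (hsph ht) hf
  have h2 : Real.circleAverage (fun t => discMapSup D a (γ t) - 1) 0 1 =
      Real.circleAverage (fun t => discMapSup D a (γ t)) 0 1 - 1 := by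
    rw [Real.circleAverage_fun_sub hint (circleIntegrable_const _ _ _), Real.circleAverage_const]
  change discMapSup D a p - 1 ≤ Real.circleAverage (fun t => discMapSup D a (γ t) - 1) 0 1
  rw [h2]
  linarith

end DiscMapSup

namespace IsCConvexDomain

variable {n : ℕ} {D : Set (CSpace n)}

theorem isHyperconvex (hD : IsCConvexDomain D) (hline : ¬ ContainsComplexLine D) :
    IsHyperconvex D := by
  obtain ⟨a, ha⟩ := hD.isCDomain.isConnected.nonempty
  refine ⟨fun z => discMapSup D a z - 1, contPlurisubharmonicOn_discMapSup hD.isCDomain.isOpen,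
    fun z hz => by linarith [discMapSup_lt_one hD.isCDomain ha hz], fun t ht => ?_⟩
  refine (hD.relCompactIn_discMap_le hline ha (ρ := 1 - t) (by linarith)).mono ?_
  rintro z ⟨hz, h⟩
  exact ⟨hz, fun f hf => by linarith [norm_le_discMapSup hz hf]⟩

theorem isTaut (hD : IsCConvexDomain D) (hline : ¬ ContainsComplexLine D) : IsTaut D := by
  obtain ⟨a, ha⟩ := hD.isCDomain.isConnected.nonempty
  intro φ hφ
  by_cases hdiv : ∀ K : Set ℂ, IsCompact K → K ⊆ ball 0 1 → ∀ L : Set (CSpace n), IsCompact L →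
      L ⊆ D → ∀ᶠ j in atTop, Disjoint (φ j '' K) L
  · exact ⟨id, strictMono_id, Or.inr hdiv⟩
  push Not at hdiv
  obtain ⟨K, hK, hKb, L, hL, hLD, hfreq⟩ := hdiv
  obtain ⟨s, hs, hmeet⟩ := extraction_of_frequently_atTop hfreq
  have hpt : ∀ j, ∃ ω ∈ K, φ (s j) ω ∈ L := by
    intro j
    obtain ⟨_, ⟨ω, hω, rfl⟩, h⟩ := Set.not_disjoint_iff.mp (hmeet j)
    exact ⟨ω, hω, h⟩
  choose ω hωK hωL using hpt
  obtain ⟨ρ, hρ1, hρ⟩ : ∃ ρ < 1, ∀ z ∈ L, discMapSup D a z ≤ ρ := by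
    obtain ⟨p, hp, hmax⟩ := hL.exists_isMaxOn ⟨_, hωL 0⟩
      ((continuousOn_discMapSup (a := a) hD.isCDomain.isOpen).mono hLD)
    exact ⟨_, discMapSup_lt_one hD.isCDomain ha (hLD hp), fun z hz => hmax hz⟩
  obtain ⟨r₀, hr₀1, hr₀⟩ : ∃ r < 1, ∀ z ∈ K, ‖z‖ ≤ r := by
    obtain ⟨p, hp, hmax⟩ := hK.exists_isMaxOn ⟨_, hωK 0⟩ continuous_norm.continuousOn
    exact ⟨_, mem_ball_zero_iff.mp (hKb hp), fun z hz => hmax hz⟩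
  -- Each disc meets `L` at a parameter `ω j` in `K`, at Möbius distance at most some `m < 1` from
  -- every `ζ` with `‖ζ‖ ≤ r`. Schwarz–Pick turns the bound `ρ` on `L` into one below 1 that is
  -- uniform in `j`.
  have hcomp : ∀ r < 1, ∃ C, IsCompact C ∧ C ⊆ D ∧ ∀ j ζ, ‖ζ‖ ≤ r → φ (s j) ζ ∈ C := by
    intro r hr
    obtain ⟨m, hm0, hm1, hm⟩ := exists_moebiusMap_le (max_lt hr hr₀1)
    obtain ⟨hc, hcD⟩ := hD.relCompactIn_discMap_le hline ha (sqrt_one_sub_lt_one hm0 hm1 hρ1)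
    refine ⟨_, hc, hcD, fun j ζ hζ => subset_closure ?_⟩
    have hζD := (hφ (s j)).2 (mem_ball_zero_iff.mpr (hζ.trans_lt hr))
    refine ⟨hζD, fun f hf => (norm_le_discMapSup hζD hf).trans ?_⟩
    exact discMapSup_le_of_disc (hφ (s j)).1 (hφ (s j)).2 (hζ.trans_lt hr)
      (mem_ball_zero_iff.mp (hKb (hωK j))) hm1
      (hm _ _ (hζ.trans (le_max_left _ _)) ((hr₀ _ (hωK j)).trans (le_max_right _ _))) hρ1
      (hρ _ (hωL j))
  obtain ⟨σ, hσ, ψ, hψ, hlim⟩ := exists_subseq_tendstoLocallyUniformlyOn isOpen_ball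
    (fun j => (hφ (s j)).1) (fun z hz => by
      rw [mem_ball_zero_iff] at hz
      obtain ⟨C, hC, -, hCm⟩ := hcomp ((1 + ‖z‖) / 2) (by linarith)
      obtain ⟨M, hM⟩ := isBounded_iff_forall_norm_le.mp hC.isBounded
      refine ⟨(1 - ‖z‖) / 2, by linarith, M, fun j w hw _ => hM _ (hCm j w ?_)⟩
      rw [mem_ball, dist_eq_norm] at hw
      linarith [norm_sub_norm_le w z])
  -- The limit stays in `D`, and not merely in its closure, because the values at `ζ` lie in one
  -- compact subset of `D`.
  refine ⟨s ∘ σ, hs.comp hσ, Or.inl ⟨ψ, hψ, fun ζ hζ => ?_, hlim⟩⟩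
  obtain ⟨C, hC, hCD, hCm⟩ := hcomp ‖ζ‖ (mem_ball_zero_iff.mp hζ)
  exact hCD (hC.isClosed.mem_of_tendsto (hlim.tendsto_at hζ)
    (.of_forall fun j => hCm _ ζ le_rfl))

end IsCConvexDomain

theorem theoremc (n : ℕ) (D : Set (CSpace n)) (hD : IsCConvexDomain D)
    (hline : ¬ ContainsComplexLine D) :
    (∃ G : Set (CSpace n), IsCDomain G ∧ Bornology.IsBounded G ∧ AreBiholomorphic D G) ∧
      IsCFinitelyCompact D ∧ IsCComplete D ∧ IsHyperconvex D ∧ IsTaut D :=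
  ⟨hD.exists_biholomorphic_bounded hline, hD.isCFinitelyCompact hline, hD.isCComplete hline,
    hD.isHyperconvex hline, hD.isTaut hline⟩
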